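/- Let $G=\mathbb C^n\ltimes_\varphi\mathbb C^m$, where $\varphi$ is a continuous action of $\mathbb C^n$ on $\mathbb C^m$ by $\mathbb C$-linear automorphisms which is semisimple, and let $\Gamma=\Gamma_{\mathbb C^n}\ltimes_\varphi\Gamma_{\mathbb C^m}$ with lattices $\Gamma_{\mathbb C^n}\subset\mathbb C^n$, $\Gamma_{\mathbb C^m}\subset\mathbb C^m$ such that $\varphi(z)(\Gamma_{\mathbb C^m})\subseteq\Gamma_{\mathbb C^m}$ for all $z\in\Gamma_{\mathbb C^n}$ (a splitting-type solvmanifold $G/\Gamma$). Let $Y_1,\dots,Y_m$ be a basis of $\mathbb C^m$ with $\varphi(z)Y_j=\alpha_j(z)Y_j$ for characters $\alpha_j:\mathbb C^n\to\mathbb C^*$, let $\beta_j,\gamma_j$ be the unitary characters of $\mathbb C^n$ such that $\alpha_j\beta_j^{-1}$ and $\bar\alpha_j\gamma_j^{-1}$ are holomorphic, and let $x_1,\dots,x_n$, $y_1,\dots,y_m$ be the closed $(1,0)$-forms dual to the standard basis of $\mathbb C^n$ and to $Y_1,\dots,Y_m$. Let $B_\Gamma^{p,q}$ be the complex span of the forms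 $x_I\wedge(\alpha_J^{-1}\beta_J)y_J\wedge\bar x_K\wedge(\bar\alpha_L^{-1}\gamma_L)\bar y_L$ with $|I|+|J|=p$, $|K|+|L|=q$ and $(\beta_J\gamma_L)|_\Gamma=1$; let $\bar B_\Gamma^{p,q}$ be the space of the conjugates of the elements of $B_\Gamma^{q,p}$, and let $C_\Gamma^{p,q}=B_\Gamma^{p,q}+\bar B_\Gamma^{p,q}$, a space of $(p,q)$-forms on $G/\Gamma$ (that is, of $\Gamma$-invariant forms on $G$). Then: 1. $\bar\partial=0$ on $B_\Gamma^{\bullet,\bullet}$ and $\partial=0$ on $\bar B_\Gamma^{\bullet,\bullet}$. 2. $(C_\Gamma^{\bullet,\bullet},\partial,\bar\partial)$ is a double complex of forms on $G/\Gamma$. It is a direct sum of finitely many dots (one-dimensional double complexes) and zigzags of length $2$ (two one-dimensional components joined by an isomorphism $\partial$ or $\bar\partial$), and every decomposition of it into a direct sum of squares and zigzags consists of dots and zigzags of length $2$ only. 3. $C_\Gamma^{\bullet,\bullet}$ has the page-$1$-$\partial\bar\partial$-property: its Frölicher spectral sequence (and the conjugate one) degenerates at page $2$, and the Hodge filtration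 induces a pure Hodge structure of weight $k$ on its de Rham cohomology in each degree $k$. 4. If a decomposition of $C_\Gamma^{\bullet,\bullet}$ into squares and zigzags contains no lines (zigzags of length $2$), then $C_\Gamma^{\bullet,\bullet}$ satisfies the $\partial\bar\partial$-Lemma: every element that is $\partial$-closed, $\bar\partial$-closed and exact for $d=\partial+\bar\partial$ in $C_\Gamma^{\bullet,\bullet}$ is of the form $\partial\bar\partial\eta$ with $\eta\in C_\Gamma^{\bullet,\bullet}$. -/

import Mathlib

noncomputable section

/-! ### Double complexes

A double complex is given by a module `V` with two endomorphisms `d1` (playing the role of `∂`) and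
`d2` (playing the role of `∂̄`), and a family `A p q` of submodules of `V`, its bigraded pieces. -/

namespace DoubleComplex

variable {K V : Type*} [Field K] [AddCommGroup V] [Module K V]

/-- The pieces `D p q` are mapped to `D (p+1) q` by `d1` and to `D p (q+1)` by `d2`. -/
def IsStable (d1 d2 : V →ₗ[K] V) (D : ℤ → ℤ → Submodule K V) : Prop :=
  (∀ p q, ∀ a ∈ D p q, d1 a ∈ D (p + 1) q) ∧ (∀ p q, ∀ a ∈ D p q, d2 a ∈ D p (q + 1))

/-- `(⨁ A p q, d1, d2)` is a double complex: the sum of the `A p q` is direct, the operators have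
bidegrees `(1,0)` and `(0,1)`, square to zero and anticommute. -/
structure IsDoubleComplex (d1 d2 : V →ₗ[K] V) (A : ℤ → ℤ → Submodule K V) : Prop where
  independent : iSupIndep (fun v : ℤ × ℤ => A v.1 v.2)
  stable : IsStable d1 d2 A
  d1_d1 : ∀ p q, ∀ a ∈ A p q, d1 (d1 a) = 0
  d2_d2 : ∀ p q, ∀ a ∈ A p q, d2 (d2 a) = 0
  anticomm : ∀ p q, ∀ a ∈ A p q, d1 (d2 a) + d2 (d1 a) = 0

/-- The underlying vector space `⨁_{p,q} A p q`. -/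
def total (A : ℤ → ℤ → Submodule K V) : Submodule K V := ⨆ p, ⨆ q, A p q

/-! #### Squares, zigzags and decompositions -/

/-- The shape of a square: `{(p,q), (p+1,q), (p,q+1), (p+1,q+1)}`. -/
def IsSquareShape (S : Set (ℤ × ℤ)) : Prop :=
  ∃ p q : ℤ, S = {(p, q), (p + 1, q), (p, q + 1), (p + 1, q + 1)}

/-- The infinite staircase `…, (p,q), (p,q-1), (p+1,q-1), (p+1,q-2), …` through `(p,q)`.
Two consecutive points are the source and the target of an arrow `d1` or `d2`. -/
def staircase (p q j : ℤ) : ℤ × ℤ := (p + j / 2, q - (j + 1) / 2)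

/-- The shape of a zigzag of length `l ≥ 1`: `l` consecutive points of a staircase. -/
def IsZigzagShape (l : ℕ) (S : Set (ℤ × ℤ)) : Prop :=
  1 ≤ l ∧ ∃ p q a : ℤ, S = staircase p q '' Set.Ico a (a + l)

/-- Dots are the zigzags of length one. -/
def IsDotShape (S : Set (ℤ × ℤ)) : Prop := IsZigzagShape 1 S

/-- Lines are the zigzags of length two. -/
def IsLineShape (S : Set (ℤ × ℤ)) : Prop := IsZigzagShape 2 S

/-- Shapes of squares and zigzags. -/
def IsElementaryShape (S : Set (ℤ × ℤ)) : Prop :=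
  IsSquareShape S ∨ ∃ l : ℕ, IsZigzagShape l S

/-- The components of `D` are one dimensional on `S` and zero outside `S`, and all arrows of `D`
between two points of `S` are isomorphisms. -/
structure HasShape (d1 d2 : V →ₗ[K] V) (D : ℤ → ℤ → Submodule K V) (S : Set (ℤ × ℤ)) : Prop where
  finrank_eq_one : ∀ p q, (p, q) ∈ S → Module.finrank K (D p q) = 1
  eq_bot : ∀ p q, (p, q) ∉ S → D p q = ⊥
  bijOn_d1 : ∀ p q, (p, q) ∈ S → (p + 1, q) ∈ S → Set.BijOn d1 (D p q) (D (p + 1) q)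
  bijOn_d2 : ∀ p q, (p, q) ∈ S → (p, q + 1) ∈ S → Set.BijOn d2 (D p q) (D p (q + 1))

/-- `A` is the internal direct sum of its sub-double complexes `D i`, and each `D i` is a square or
a zigzag, of shape `S i`. -/
structure IsDecomposition (d1 d2 : V →ₗ[K] V) (A : ℤ → ℤ → Submodule K V) {ι : Type}
    (D : ι → ℤ → ℤ → Submodule K V) (S : ι → Set (ℤ × ℤ)) : Prop where
  stable : ∀ i, IsStable d1 d2 (D i)
  independent : ∀ p q, iSupIndep (fun i => D i p q)
  iSup_eq : ∀ p q, ⨆ i, D i p q = A p q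
  elementary : ∀ i, IsElementaryShape (S i)
  hasShape : ∀ i, HasShape d1 d2 (D i) (S i)

/-! #### The `∂∂̄`-Lemma -/

/-- The `∂∂̄`-Lemma for a double complex: every element that is `d1`-closed, `d2`-closed and exact
for `d1 + d2` is in the image of `d1 ∘ d2`. -/
def SatisfiesDdbarLemma (d1 d2 : V →ₗ[K] V) (A : ℤ → ℤ → Submodule K V) : Prop :=
  ∀ a ∈ total A, d1 a = 0 → d2 a = 0 → (∃ b ∈ total A, (d1 + d2) b = a) →
    ∃ c ∈ total A, d1 (d2 c) = a

/-! #### The Frölicher spectral sequence, the Hodge filtration, and the page-1 property -/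

/-- The part of total degree `k`. -/
def tot (A : ℤ → ℤ → Submodule K V) (k : ℤ) : Submodule K V := ⨆ p, A p (k - p)

/-- The filtration `F^p = ⨁_{p' ≥ p} A^{p',k-p'}` of the part of total degree `k`. -/
def filt (A : ℤ → ℤ → Submodule K V) (p k : ℤ) : Submodule K V :=
  ⨆ p' : ℤ, ⨆ _ : p ≤ p', A p' (k - p')

/-- The approximate cycles `Z_r^p` in total degree `k`: elements of `F^p` whose total differential
lies in `F^{p+r}`. -/
def approxCycles (d : V →ₗ[K] V) (A : ℤ → ℤ → Submodule K V) (r p k : ℤ) : Submodule K V :=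
  filt A p k ⊓ (filt A (p + r) (k + 1)).comap d

/-- The denominators `Z_{r-1}^{p+1} + d Z_{r-1}^{p-r+1}` in total degree `k`, so that
`E_r^{p,k-p} = Z_r^p / (Z_{r-1}^{p+1} + d Z_{r-1}^{p-r+1})`. -/
def pageDenominator (d : V →ₗ[K] V) (A : ℤ → ℤ → Submodule K V) (r p k : ℤ) : Submodule K V :=
  approxCycles d A (r - 1) (p + 1) k ⊔ (approxCycles d A (r - 1) (p - r + 1) (k - 1)).map d

/-- The spectral sequence of the filtration `filt A` (the Frölicher spectral sequence, with first
page the `d2`-cohomology) degenerates at page `r₀`: for all `r ≥ r₀` the differential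
`d_r : E_r^{p,k-p} → E_r^{p+r,k+1-p-r}`, `[a] ↦ [d a]`, vanishes. -/
def DegeneratesAt (d1 d2 : V →ₗ[K] V) (A : ℤ → ℤ → Submodule K V) (r₀ : ℤ) : Prop :=
  ∀ r : ℤ, r₀ ≤ r → ∀ p k : ℤ, ∀ a ∈ approxCycles (d1 + d2) A r p k,
    (d1 + d2) a ∈ pageDenominator (d1 + d2) A r (p + r) (k + 1)

/-- The closed elements of total degree `k`. -/
def cocycles (d : V →ₗ[K] V) (A : ℤ → ℤ → Submodule K V) (k : ℤ) : Submodule K V :=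
  tot A k ⊓ LinearMap.ker d

/-- The exact elements of total degree `k`. -/
def coboundaries (d : V →ₗ[K] V) (A : ℤ → ℤ → Submodule K V) (k : ℤ) : Submodule K V :=
  (tot A (k - 1)).map d

/-- The de Rham cohomology (cohomology of the total complex) in degree `k`. -/
abbrev DeRham (d : V →ₗ[K] V) (A : ℤ → ℤ → Submodule K V) (k : ℤ) : Type _ :=
  cocycles d A k ⧸ (coboundaries d A k).submoduleOf (cocycles d A k)

/-- The subspace of the de Rham cohomology of the classes that have a closed representative
in `F`. -/
def classesIn (d : V →ₗ[K] V) (A : ℤ → ℤ → Submodule K V) (k : ℤ) (F : Submodule K V) :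
    Submodule K (DeRham d A k) :=
  (F.submoduleOf (cocycles d A k)).map
    ((coboundaries d A k).submoduleOf (cocycles d A k)).mkQ

/-- The double complex with the roles of the two degrees exchanged. -/
def swap (A : ℤ → ℤ → Submodule K V) : ℤ → ℤ → Submodule K V := fun p q => A q p

/-- In every degree `k` the Hodge filtration `F` on de Rham cohomology, together with the opposite
filtration `F̄` (given by the second degree), is a pure Hodge structure of weight `k`:
`H^k = F^p ⊕ F̄^{k+1-p}` for all `p`. -/
def HodgeFiltrationIsPure (d1 d2 : V →ₗ[K] V) (A : ℤ → ℤ → Submodule K V) : Prop :=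
  ∀ k p : ℤ, IsCompl (classesIn (d1 + d2) A k (filt A p k))
    (classesIn (d1 + d2) A k (filt (swap A) (k + 1 - p) k))

/-- The page-`1`-`∂∂̄`-property: the Frölicher spectral sequence and its conjugate degenerate at
page `2`, and the Hodge filtration induces a pure Hodge structure on de Rham cohomology. -/
structure HasPageOneDdbarProperty (d1 d2 : V →ₗ[K] V) (A : ℤ → ℤ → Submodule K V) : Prop where
  degenerates : DegeneratesAt d1 d2 A 2
  degenerates_conj : DegeneratesAt d2 d1 (swap A) 2
  pure : HodgeFiltrationIsPure d1 d2 A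

end DoubleComplex

/-! ### Complex differential forms on `ℂⁿ × ℂᵐ` -/

/-- The complex vector space `ℂⁿ × ℂᵐ`. -/
abbrev Coord (n m : ℕ) : Type := (Fin n → ℂ) × (Fin m → ℂ)

namespace Forms

/-- Smooth complex valued differential forms of degree `k` on `ℂⁿ × ℂᵐ`. -/
def FormDeg (n m k : ℕ) : Submodule ℂ (Coord n m → Coord n m [⋀^Fin k]→L[ℝ] ℂ) where
  carrier := {ω | ContDiff ℝ ((⊤ : ℕ∞) : WithTop ℕ∞) ω}
  add_mem' := by
    intro ω η hω hη
    rw [Set.mem_ofPred_eq] at *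
    exact hω.add hη
  zero_mem' := by
    rw [Set.mem_ofPred_eq]
    exact contDiff_const
  smul_mem' := by
    intro c ω hω
    rw [Set.mem_ofPred_eq] at *
    exact hω.const_smul c

/-- Differential forms of all degrees. Only the degrees `k ≤ 2(n+m)` contain nonzero forms, so the
product over the degrees is the direct sum. -/
abbrev AllForms (n m : ℕ) : Type := (k : ℕ) → FormDeg n m k

instance (n m : ℕ) : AddCommGroup (AllForms n m) := Pi.addCommGroup

instance (n m : ℕ) : Module ℂ (AllForms n m) := Pi.module _ _ _

variable {n m : ℕ}

theorem FormDeg.contDiff {k : ℕ} (ω : FormDeg n m k) :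
    ContDiff ℝ ((⊤ : ℕ∞) : WithTop ℕ∞) ω.1 := ω.2

theorem FormDeg.differentiableAt {k : ℕ} (ω : FormDeg n m k) (x : Coord n m) :
    DifferentiableAt ℝ ω.1 x := (FormDeg.contDiff ω).differentiable (by simp) x

/-- Multiplication by `i` on `ℂⁿ × ℂᵐ`, as a real linear map. -/
def mulI : Coord n m →L[ℝ] Coord n m := Complex.I • ContinuousLinearMap.id ℝ (Coord n m)

/-- The complex linear part (`ε = 1`) or the complex antilinear part (`ε = -1`) of a real
linear map `L`, namely `v ↦ (L v - ε i L (i v)) / 2`. -/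
def typePart {F : Type*} [NormedAddCommGroup F] [NormedSpace ℝ F] [NormedSpace ℂ F]
    [SMulCommClass ℝ ℂ F] (ε : ℂ) (L : Coord n m →L[ℝ] F) : Coord n m →L[ℝ] F :=
  (1 / 2 : ℂ) • (L - (ε * Complex.I) • L.comp mulI)

/-- The part of the exterior derivative of a form `ω` on `ℂⁿ × ℂᵐ` that takes derivatives in
the holomorphic directions (`ε = 1`), so `∂ (f dz_I ∧ dz̄_J) = ∑ i, ∂f/∂z_i dz_i ∧ dz_I ∧ dz̄_J`,
or in the antiholomorphic directions (`ε = -1`), so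
`∂̄ (f dz_I ∧ dz̄_J) = ∑ i, ∂f/∂z̄_i dz̄_i ∧ dz_I ∧ dz̄_J`.
It is obtained from `extDeriv` by replacing the derivative of the coefficients by its complex
linear, or complex antilinear, part. -/
def partialDeriv (ε : ℂ) {k : ℕ} (ω : Coord n m → Coord n m [⋀^Fin k]→L[ℝ] ℂ) (x : Coord n m) :
    Coord n m [⋀^Fin (k + 1)]→L[ℝ] ℂ :=
  ContinuousAlternatingMap.alternatizeUncurryFin (typePart ε (fderiv ℝ ω x))

theorem typePart_add {F : Type*} [NormedAddCommGroup F] [NormedSpace ℝ F] [NormedSpace ℂ F]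
    [SMulCommClass ℝ ℂ F] (ε : ℂ) (L M : Coord n m →L[ℝ] F) :
    typePart ε (L + M) = typePart ε L + typePart ε M := by
  refine ContinuousLinearMap.ext fun v => ?_
  simp [typePart]
  module

theorem typePart_smul {F : Type*} [NormedAddCommGroup F] [NormedSpace ℝ F] [NormedSpace ℂ F]
    [SMulCommClass ℝ ℂ F] (ε c : ℂ) (L : Coord n m →L[ℝ] F) :
    typePart ε (c • L) = c • typePart ε L := by
  refine ContinuousLinearMap.ext fun v => ?_
  simp [typePart]
  module

theorem alternatize_smul {k : ℕ} (c : ℂ) (L : Coord n m →L[ℝ] Coord n m [⋀^Fin k]→L[ℝ] ℂ) :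
    ContinuousAlternatingMap.alternatizeUncurryFin (c • L)
      = c • ContinuousAlternatingMap.alternatizeUncurryFin L := by
  ext v
  simp [ContinuousAlternatingMap.alternatizeUncurryFin_apply, Finset.mul_sum]

theorem contDiff_partialDeriv (ε : ℂ) {k : ℕ} {ω : Coord n m → Coord n m [⋀^Fin k]→L[ℝ] ℂ}
    (h : ContDiff ℝ ((⊤ : ℕ∞) : WithTop ℕ∞) ω) :
    ContDiff ℝ ((⊤ : ℕ∞) : WithTop ℕ∞) (partialDeriv ε ω) := by
  have h1 : ContDiff ℝ ((⊤ : ℕ∞) : WithTop ℕ∞) (fderiv ℝ ω) := h.fderiv_right (by simp)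
  have h2 : ContDiff ℝ ((⊤ : ℕ∞) : WithTop ℕ∞) (fun x => typePart ε (fderiv ℝ ω x)) :=
    ContDiff.const_smul _ (h1.sub (ContDiff.const_smul _ (h1.clm_comp contDiff_const)))
  exact (ContinuousAlternatingMap.alternatizeUncurryFinCLM ℝ (Coord n m) ℂ).contDiff.comp h2

/-- `partialDeriv` as a linear map on smooth forms of degree `k`. -/
def partialDerivDeg (ε : ℂ) (k : ℕ) : FormDeg n m k →ₗ[ℂ] FormDeg n m (k + 1) where
  toFun ω := ⟨partialDeriv ε ω.1, contDiff_partialDeriv ε ω.2⟩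
  map_add' ω η := by
    ext1
    funext x
    have h1 : DifferentiableAt ℝ ω.1 x := FormDeg.differentiableAt ω x
    have h2 : DifferentiableAt ℝ η.1 x := FormDeg.differentiableAt η x
    change partialDeriv ε (ω.1 + η.1) x = partialDeriv ε ω.1 x + partialDeriv ε η.1 x
    simp only [partialDeriv, fderiv_add h1 h2, typePart_add,
      ContinuousAlternatingMap.alternatizeUncurryFin_add]
  map_smul' c ω := by
    ext1
    funext x
    have h1 : DifferentiableAt ℝ ω.1 x := FormDeg.differentiableAt ω x
    change partialDeriv ε (c • ω.1) x = c • partialDeriv ε ω.1 x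
    simp only [partialDeriv, fderiv_const_smul h1, typePart_smul, alternatize_smul]

/-- `partialDeriv` on forms of all degrees. -/
def partialDerivAll (ε : ℂ) : AllForms n m →ₗ[ℂ] AllForms n m :=
  LinearMap.pi fun k => match k with
    | 0 => 0
    | k + 1 => (partialDerivDeg ε k).comp (LinearMap.proj k)

/-- The operator `∂`. -/
def del (n m : ℕ) : AllForms n m →ₗ[ℂ] AllForms n m := partialDerivAll 1

/-- The operator `∂̄`. -/
def delbar (n m : ℕ) : AllForms n m →ₗ[ℂ] AllForms n m := partialDerivAll (-1)

/-- Complex conjugation of forms, `ω ↦ ω̄`. -/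
def conj : AllForms n m →ₛₗ[starRingEnd ℂ] AllForms n m where
  toFun ω k := ⟨fun x => (Complex.conjCLE : ℂ →L[ℝ] ℂ).compContinuousAlternatingMap ((ω k).1 x), 
    (ContinuousLinearMap.compContinuousAlternatingMapCLM ℝ (Coord n m) ℂ ℂ (Fin k)
      (Complex.conjCLE : ℂ →L[ℝ] ℂ)).contDiff.comp (FormDeg.contDiff (ω k))⟩
  map_add' ω η := by
    funext k
    ext x v
    simp
  map_smul' c ω := by
    funext k
    ext x v
    simp

/-- The wedge product `θ₁ ∧ … ∧ θ_k` of a list of constant coefficient `1`-forms,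
`(v₁, …, v_k) ↦ det (θ_i (v_j))`. -/
def wedge (l : List (Coord n m →L[ℝ] ℂ)) : Coord n m [⋀^Fin l.length]→L[ℝ] ℂ :=
  ContinuousMultilinearMap.alternatization
    ((ContinuousMultilinearMap.mkPiAlgebra ℝ (Fin l.length) ℂ).compContinuousLinearMap l.get)

/-- A constant coefficient form, viewed in the family of its components in all degrees. -/
def inDegree {k : ℕ} (c : Coord n m [⋀^Fin k]→L[ℝ] ℂ) :
    (j : ℕ) → Coord n m [⋀^Fin j]→L[ℝ] ℂ :=
  Pi.single k c

end Forms

/-! ### Splitting-type solvmanifolds with group `ℂⁿ ⋉ ℂᵐ` -/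

/-- The group automorphism of (the additive group of) `ℂᵐ` given by a complex linear map. -/
def toMulAut (m : ℕ) :
    ((Fin m → ℂ) ≃ₗ[ℂ] (Fin m → ℂ)) →* MulAut (Multiplicative (Fin m → ℂ)) where
  toFun f := AddEquiv.toMultiplicative f.toAddEquiv
  map_one' := rfl
  map_mul' _ _ := rfl

/-- A splitting-type solvmanifold `G/Γ` with `G = ℂⁿ ⋉_φ ℂᵐ`: the data of

* an action `φ` of `ℂⁿ` on `ℂᵐ` by holomorphic automorphisms of the complex Lie group `ℂᵐ`, that is,
  by complex linear automorphisms, depending continuously on `z ∈ ℂⁿ`;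
* lattices in `ℂⁿ` and in `ℂᵐ`, the second one being stable under the action of the first one;

such that the action of `ℂⁿ` on the Lie algebra `ℂᵐ` is semisimple. -/
structure SplittingSolvmanifold (n m : ℕ) where
  φ : Multiplicative (Fin n → ℂ) →* ((Fin m → ℂ) ≃ₗ[ℂ] (Fin m → ℂ))
  continuous_φ : ∀ w : Fin m → ℂ, Continuous fun z : Fin n → ℂ => φ (Multiplicative.ofAdd z) w
  semisimple : ∀ z, Module.End.IsSemisimple (φ z).toLinearMap
  latticeBase : Submodule ℤ (Fin n → ℂ)
  discrete_base : DiscreteTopology latticeBase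
  span_base : Submodule.span ℝ (latticeBase : Set (Fin n → ℂ)) = ⊤
  latticeFiber : Submodule ℤ (Fin m → ℂ)
  discrete_fiber : DiscreteTopology latticeFiber
  span_fiber : Submodule.span ℝ (latticeFiber : Set (Fin m → ℂ)) = ⊤
  stable : ∀ z ∈ latticeBase, ∀ w ∈ latticeFiber, φ (Multiplicative.ofAdd z) w ∈ latticeFiber

namespace SplittingSolvmanifold

open Forms

variable {n m : ℕ} (X : SplittingSolvmanifold n m)

/-- The Lie group `G = ℂⁿ ⋉_φ ℂᵐ`. -/
abbrev G : Type :=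
  SemidirectProduct (Multiplicative (Fin m → ℂ)) (Multiplicative (Fin n → ℂ))
    ((toMulAut m).comp X.φ)

/-- The global coordinates on `G`. -/
def coord : X.G ≃ Coord n m where
  toFun g := (g.right.toAdd, g.left.toAdd)
  invFun x := ⟨Multiplicative.ofAdd x.2, Multiplicative.ofAdd x.1⟩
  left_inv _ := rfl
  right_inv _ := rfl

/-- The lattice `Γ = Γ_{ℂⁿ} ⋉ Γ_{ℂᵐ}` of `G`. -/
def Γ : Subgroup X.G where
  carrier := {g | g.right.toAdd ∈ X.latticeBase ∧ g.left.toAdd ∈ X.latticeFiber}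
  one_mem' := ⟨X.latticeBase.zero_mem, X.latticeFiber.zero_mem⟩
  mul_mem' {_ _} hg hh := ⟨X.latticeBase.add_mem hg.1 hh.1,
    X.latticeFiber.add_mem hg.2 (X.stable _ hg.1 _ hh.2)⟩
  inv_mem' {_} hg := ⟨X.latticeBase.neg_mem hg.1,
    X.stable _ (X.latticeBase.neg_mem hg.1) _ (X.latticeFiber.neg_mem hg.2)⟩

/-- Left translation by `g` on `G`, in coordinates. -/
def leftTranslation (g : X.G) : Coord n m → Coord n m := fun x => X.coord (g * X.coord.symm x)

/-- The space of differential forms on the solvmanifold, that is, of forms on `G` that are invariant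
under pull-back by the left translations by elements of `Γ`. -/
def quotientForms : Submodule ℂ (AllForms n m) where
  carrier := {ω | ∀ g ∈ X.Γ, ∀ (k : ℕ) (x : Coord n m),
    ((ω k).1 (X.leftTranslation g x)).compContinuousLinearMap
      (fderiv ℝ (X.leftTranslation g) x) = (ω k).1 x}
  add_mem' {ω η} hω hη g hg k x := by
    change _ = (ω k).1 x + (η k).1 x
    rw [← hω g hg k x, ← hη g hg k x]
    rfl
  zero_mem' _ _ _ _ := rfl
  smul_mem' c ω hω g hg k x := by
    change _ = c • (ω k).1 x
    rw [← hω g hg k x]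
    rfl

/-- A basis `Y₁, …, Y_m` of the Lie algebra of `ℂᵐ` that diagonalizes the action, with characters
`α₁, …, α_m : ℂⁿ → ℂˣ`, together with the unitary characters `β_j` and `γ_j` of `ℂⁿ` for which
`α_j β_j⁻¹` and `ᾱ_j γ_j⁻¹` are holomorphic. -/
structure Frame where
  Y : Module.Basis (Fin m) ℂ (Fin m → ℂ)
  α : Fin m → AddChar (Fin n → ℂ) ℂ
  continuous_α : ∀ j, Continuous (α j)
  action : ∀ (z : Fin n → ℂ) (j : Fin m), X.φ (Multiplicative.ofAdd z) (Y j) = α j z • Y j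
  β : Fin m → AddChar (Fin n → ℂ) ℂ
  continuous_β : ∀ j, Continuous (β j)
  unitary_β : ∀ j z, ‖β j z‖ = 1
  holomorphic_β : ∀ j, Differentiable ℂ (fun z => α j z * (β j z)⁻¹)
  γ : Fin m → AddChar (Fin n → ℂ) ℂ
  continuous_γ : ∀ j, Continuous (γ j)
  unitary_γ : ∀ j z, ‖γ j z‖ = 1
  holomorphic_γ : ∀ j, Differentiable ℂ (fun z => starRingEnd ℂ (α j z) * (γ j z)⁻¹)

namespace Frame

variable {X} (F : X.Frame)

/-- The `1`-form `x_i`, dual to the `i`-th standard basis vector of `ℂⁿ`. -/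
def x (i : Fin n) : Coord n m →L[ℝ] ℂ :=
  (ContinuousLinearMap.proj (R := ℝ) (φ := fun _ : Fin n => ℂ) i).comp
    (ContinuousLinearMap.fst ℝ (Fin n → ℂ) (Fin m → ℂ))

/-- The `1`-form `y_j` on `ℂᵐ`, dual to `Y_j`. -/
def y (j : Fin m) : Coord n m →L[ℝ] ℂ :=
  (LinearMap.toContinuousLinearMap ((F.Y.coord j).restrictScalars ℝ)).comp
    (ContinuousLinearMap.snd ℝ (Fin n → ℂ) (Fin m → ℂ))

/-- The conjugate of a `1`-form. -/
def bar (θ : Coord n m →L[ℝ] ℂ) : Coord n m →L[ℝ] ℂ := (Complex.conjCLE : ℂ →L[ℝ] ℂ).comp θ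

/-- The constant coefficient form `x_I ∧ y_J ∧ x̄_K ∧ ȳ_L`. -/
def wedgeXY (I : Finset (Fin n)) (J : Finset (Fin m)) (K : Finset (Fin n)) (L : Finset (Fin m)) :
    (k : ℕ) → Coord n m [⋀^Fin k]→L[ℝ] ℂ :=
  inDegree (wedge (I.sort.map x ++ J.sort.map F.y ++ K.sort.map (fun i => bar (x i)) ++
    L.sort.map (fun j => bar (F.y j))))

/-- The function `(α_J⁻¹ β_J) (ᾱ_L⁻¹ γ_L)` on `ℂⁿ`. -/
def coeff (J L : Finset (Fin m)) (z : Fin n → ℂ) : ℂ :=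
  (∏ j ∈ J, (F.α j z)⁻¹ * F.β j z) * ∏ l ∈ L, (starRingEnd ℂ (F.α l z))⁻¹ * F.γ l z

/-- The condition `(β_J γ_L)|_Γ = 1`, where characters of `ℂⁿ` are viewed as characters of `G`. -/
def TrivialOnΓ (J L : Finset (Fin m)) : Prop :=
  ∀ g ∈ X.Γ, (∏ j ∈ J, F.β j g.right.toAdd) * ∏ l ∈ L, F.γ l g.right.toAdd = 1

/-- `B_Γ^{p,q}`: the span of the forms
`x_I ∧ (α_J⁻¹ β_J) y_J ∧ x̄_K ∧ (ᾱ_L⁻¹ γ_L) ȳ_L` with `|I| + |J| = p`, `|K| + |L| = q` and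
`(β_J γ_L)|_Γ = 1`. -/
def B (p q : ℤ) : Submodule ℂ (AllForms n m) :=
  Submodule.span ℂ {ω | ∃ (I : Finset (Fin n)) (J : Finset (Fin m)) (K : Finset (Fin n))
    (L : Finset (Fin m)), (I.card + J.card : ℤ) = p ∧ (K.card + L.card : ℤ) = q ∧
    F.TrivialOnΓ J L ∧ ∀ (k : ℕ) (x : Coord n m),
      (ω k).1 x = F.coeff J L x.1 • F.wedgeXY I J K L k}

/-- `B̄_Γ^{p,q}`, the space of the conjugates of the forms in `B_Γ^{q,p}`. -/
def Bbar (p q : ℤ) : Submodule ℂ (AllForms n m) := (F.B q p).map conj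

/-- `C_Γ^{p,q} = B_Γ^{p,q} + B̄_Γ^{p,q}`. -/
def C (p q : ℤ) : Submodule ℂ (AllForms n m) := F.B p q ⊔ F.Bbar p q

end Frame

end SplittingSolvmanifold

end

/-! Everything rests on one algebraic property, `IsShort`: in each bidegree every element is the sum
of a ∂-closed and a ∂̄-closed one, and no nonzero element is at once ∂ of one homogeneous element
and ∂̄ of another.

Why `F.C` is short (`isShort_C`): the coefficient of a generator of B is a product of holomorphic
characters of ℂⁿ, hence exp λ with λ complex linear. A generator is therefore exp(λ) w with w
constant, so its ∂̄ vanishes and its ∂ is exp(λ) λ ∧ w; conjugation exchanges the two operators on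
B̄. Thus B is ∂̄-closed and B̄ is ∂-closed, which is the first condition. For the second, ∂C = ∂B
lies in the sum of the eigenspaces of the translations of ℂⁿ for characters exp λ with λ ≠ 0 (if λ =
0 the generator is closed), while ∂̄C = ∂̄B̄ lies in the sum of those for conjugates of such
exponentials. A nontrivial holomorphic character is never antiholomorphic, and eigenspaces of
distinct characters are independent, so the two images meet in 0. Directness of the bigrading is
also an eigenspace argument: multiplication of tangent vectors by s = 2 exp(i) acts on (p,q)-forms
by s^p s̄^q, which determines (p,q).

What shortness gives: it passes to direct summands. A point with two outgoing isomorphisms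
contradicts the first condition and one with two incoming isomorphisms the second, so squares and
zigzags of length at least 3 cannot be summands. Conversely, a ∂̄-closed u with ∂u ≠ 0 spans a line
that splits off, because some functional is 1 on ∂u and kills the image of ∂̄; induction on the
dimension then yields a finite decomposition. Degeneration at page 2 and purity come from comparing
leading components: each time an equation ∂y = -∂̄w appears, both sides vanish. If there are only
dots, both operators are zero, and the ∂∂̄-Lemma is trivial. -/

noncomputable section

/-! ### Short double complexes: summands, shapes and decompositions. -/

namespace DoubleComplex

variable {K V : Type*} [Field K] [AddCommGroup V] [Module K V]
  {d1 d2 : V →ₗ[K] V} {A D A' : ℤ → ℤ → Submodule K V}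

/-- A double complex is short if its pieces are generated by `d1`-closed and `d2`-closed elements,
and no nonzero element is both `d1` of one element and `d2` of another one. -/
structure IsShort (d1 d2 : V →ₗ[K] V) (A : ℤ → ℤ → Submodule K V) : Prop where
  exists_add : ∀ p q, ∀ a ∈ A p q, ∃ b ∈ A p q, ∃ c ∈ A p q, d1 b = 0 ∧ d2 c = 0 ∧ b + c = a
  eq_zero : ∀ p q p' q', p + 1 = p' → q' + 1 = q → ∀ a ∈ A p q, ∀ b ∈ A p' q', d1 a = d2 b →
    d1 a = 0

/-- `A` is the direct sum of its sub-double complexes `D` and `A'`. -/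
structure IsSplit (d1 d2 : V →ₗ[K] V) (A D A' : ℤ → ℤ → Submodule K V) : Prop where
  stable_left : IsStable d1 d2 D
  stable_right : IsStable d1 d2 A'
  disjoint : ∀ p q, Disjoint (D p q) (A' p q)
  sup_eq : ∀ p q, D p q ⊔ A' p q = A p q

/-! #### Symmetries -/

theorem IsStable.swap (h : IsStable d1 d2 A) : IsStable d2 d1 (swap A) :=
  ⟨fun p q => h.2 q p, fun p q => h.1 q p⟩

theorem IsDoubleComplex.swap (h : IsDoubleComplex d1 d2 A) : IsDoubleComplex d2 d1 (swap A) where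
  independent := h.independent.comp (f := Prod.swap) Prod.swap_injective
  stable := h.stable.swap
  d1_d1 p q := h.d2_d2 q p
  d2_d2 p q := h.d1_d1 q p
  anticomm p q a ha := by rw [add_comm]; exact h.anticomm q p a ha

/-- Both conditions are symmetric in the two operators. Hence lines in the direction `d2` and the
conjugate spectral sequence need no separate argument. -/
theorem IsShort.swap (h : IsShort d1 d2 A) : IsShort d2 d1 (swap A) where
  exists_add p q a ha := by
    obtain ⟨b, hb, c, hc, h1, h2, h3⟩ := h.exists_add q p a ha
    exact ⟨c, hc, b, hb, h2, h1, by rw [add_comm, h3]⟩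
  eq_zero p q p' q' hp hq a ha b hb hab := by
    rw [hab]
    exact h.eq_zero q' p' q p hq hp b hb a ha hab.symm

theorem IsSplit.swap (h : IsSplit d1 d2 A D A') :
    IsSplit d2 d1 (swap A) (swap D) (swap A') where
  stable_left := h.stable_left.swap
  stable_right := h.stable_right.swap
  disjoint p q := h.disjoint q p
  sup_eq p q := h.sup_eq q p

theorem IsSplit.symm (h : IsSplit d1 d2 A D A') : IsSplit d1 d2 A A' D where
  stable_left := h.stable_right
  stable_right := h.stable_left
  disjoint p q := (h.disjoint p q).symm
  sup_eq p q := by rw [sup_comm, h.sup_eq]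

theorem HasShape.swap {S : Set (ℤ × ℤ)} (h : HasShape d1 d2 D S) :
    HasShape d2 d1 (swap D) (Prod.swap ⁻¹' S) where
  finrank_eq_one p q := h.finrank_eq_one q p
  eq_bot p q := h.eq_bot q p
  bijOn_d1 p q := h.bijOn_d2 q p
  bijOn_d2 p q := h.bijOn_d1 q p

/-! #### Direct summands -/

theorem IsSplit.left_le (h : IsSplit d1 d2 A D A') (p q : ℤ) : D p q ≤ A p q :=
  h.sup_eq p q ▸ le_sup_left

theorem IsSplit.eq_zero_left (h : IsSplit d1 d2 A D A') {p q : ℤ} {x y : V} (hx : x ∈ D p q)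
    (hy : y ∈ A' p q) (hxy : x + y = 0) : x = 0 :=
  Submodule.disjoint_def.1 (h.disjoint p q) x hx (by
    rw [eq_neg_of_add_eq_zero_left hxy]; exact neg_mem hy)

/-- Projection to the summand commutes with both operators, so the closed components of an element
of `D` can be replaced by their projections to `D`. -/
theorem IsShort.of_isSplit (h : IsShort d1 d2 A) (hs : IsSplit d1 d2 A D A') :
    IsShort d1 d2 D where
  exists_add p q a ha := by
    obtain ⟨b, hb, c, hc, h1, h2, h3⟩ := h.exists_add p q a (hs.left_le p q ha)
    rw [← hs.sup_eq] at hb hc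
    obtain ⟨b1, hb1, b2, hb2, rfl⟩ := Submodule.mem_sup.1 hb
    obtain ⟨c1, hc1, c2, hc2, rfl⟩ := Submodule.mem_sup.1 hc
    refine ⟨b1, hb1, c1, hc1, ?_, ?_, ?_⟩
    · exact hs.eq_zero_left (hs.stable_left.1 _ _ _ hb1) (hs.stable_right.1 _ _ _ hb2)
        (by rw [← map_add, h1])
    · exact hs.eq_zero_left (hs.stable_left.2 _ _ _ hc1) (hs.stable_right.2 _ _ _ hc2)
        (by rw [← map_add, h2])
    · have := hs.eq_zero_left (p := p) (q := q) (sub_mem (add_mem hb1 hc1) ha)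
        (add_mem hb2 hc2) (by rw [← h3]; abel)
      exact sub_eq_zero.1 this
  eq_zero p q p' q' hp hq a ha b hb :=
    h.eq_zero p q p' q' hp hq a (hs.left_le _ _ ha) b (hs.left_le _ _ hb)

theorem IsDoubleComplex.of_isSplit (h : IsDoubleComplex d1 d2 A) (hs : IsSplit d1 d2 A D A') :
    IsDoubleComplex d1 d2 D where
  independent := h.independent.mono fun v => hs.left_le v.1 v.2
  stable := hs.stable_left
  d1_d1 p q a ha := h.d1_d1 p q a (hs.left_le _ _ ha)
  d2_d2 p q a ha := h.d2_d2 p q a (hs.left_le _ _ ha)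
  anticomm p q a ha := h.anticomm p q a (hs.left_le _ _ ha)

/-- In a short double complex, an arrow `d1` and an arrow `d2` with the same one-dimensional source
are not both injective. -/
theorem IsShort.not_injective (h : IsShort d1 d2 D) {p q : ℤ}
    (hr : Module.finrank K (D p q) = 1) (h1 : Set.InjOn d1 (D p q)) (h2 : Set.InjOn d2 (D p q)) :
    False := by
  have : D p q = ⊥ := by
    refine (Submodule.eq_bot_iff _).2 fun a ha => ?_
    obtain ⟨b, hb, c, hc, hb1, hc2, rfl⟩ := h.exists_add p q a ha
    rw [h1 hb (zero_mem _) (by rw [hb1, map_zero]), h2 hc (zero_mem _) (by rw [hc2, map_zero]),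
      add_zero]
  rw [this, finrank_bot] at hr
  exact zero_ne_one hr

/-! #### Shapes -/

theorem isDotShape_singleton (p q : ℤ) : IsDotShape {(p, q)} := by
  refine ⟨le_rfl, p, q, 0, ?_⟩
  have : Set.Ico (0 : ℤ) (0 + (1 : ℕ)) = {0} := by ext; simp; omega
  rw [this, Set.image_singleton]
  simp [staircase]

theorem isLineShape_d1 (p q : ℤ) : IsLineShape {(p, q), (p + 1, q)} := by
  refine ⟨one_le_two, p, q + 1, 1, ?_⟩
  have : Set.Ico (1 : ℤ) (1 + (2 : ℕ)) = {1, 2} := by ext; simp; omega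
  rw [this, Set.image_pair]
  simp [staircase]

theorem isLineShape_d2 (p q : ℤ) : IsLineShape {(p, q), (p, q + 1)} := by
  refine ⟨one_le_two, p, q + 1, 0, ?_⟩
  have : Set.Ico (0 : ℤ) (0 + (2 : ℕ)) = {0, 1} := by ext; simp; omega
  rw [this, Set.image_pair, Set.pair_comm]
  simp [staircase]

/-- The only shapes of squares and zigzags carried by short double complexes are dots and lines. -/
theorem IsShort.isDotShape_or_isLineShape {S : Set (ℤ × ℤ)} (h : IsShort d1 d2 D)
    (hD : HasShape d1 d2 D S) (hS : IsElementaryShape S) : IsDotShape S ∨ IsLineShape S := by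
  rcases hS with ⟨p, q, rfl⟩ | ⟨l, hl, p, q, a, hS⟩
  · exact (h.not_injective (hD.finrank_eq_one p q (by simp))
      (hD.bijOn_d1 p q (by simp) (by simp)).injOn
      (hD.bijOn_d2 p q (by simp) (by simp)).injOn).elim
  · rcases (show l = 1 ∨ l = 2 ∨ 3 ≤ l by omega) with rfl | rfl | h3
    · exact Or.inl ⟨hl, p, q, a, hS⟩
    · exact Or.inr ⟨hl, p, q, a, hS⟩
    exfalso
    have mem : ∀ j, a ≤ j → j ≤ a + 2 → staircase p q j ∈ S := fun j h1 h2 =>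
      hS ▸ ⟨j, ⟨h1, by omega⟩, rfl⟩
    -- The middle of three consecutive points decides: points of even index on the staircase receive
    -- a `d1` and a `d2`, points of odd index emit both.
    rcases Int.even_or_odd' (a + 1) with ⟨c, hc | hc⟩
    · have e0 : staircase p q (2 * c - 1) = (p + c - 1, q - c) := by
        simp only [staircase, Prod.mk.injEq]; omega
      have e1 : staircase p q (2 * c) = (p + c - 1 + 1, q - c - 1 + 1) := by
        simp only [staircase, Prod.mk.injEq]; omega
      have e2 : staircase p q (2 * c + 1) = (p + c - 1 + 1, q - c - 1) := by
        simp only [staircase, Prod.mk.injEq]; omega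
      have m0 := e0 ▸ mem (2 * c - 1) (by omega) (by omega)
      have m1 := e1 ▸ mem (2 * c) (by omega) (by omega)
      have m2 := e2 ▸ mem (2 * c + 1) (by omega) (by omega)
      have eq : q - c = q - c - 1 + 1 := by ring
      have b1 := hD.bijOn_d1 (p + c - 1) (q - c - 1 + 1) (eq ▸ m0) m1
      have b2 := hD.bijOn_d2 (p + c - 1 + 1) (q - c - 1) m2 m1
      have hr := hD.finrank_eq_one _ _ m1
      have : D (p + c - 1 + 1) (q - c - 1 + 1) = ⊥ := by
        refine (Submodule.eq_bot_iff _).2 fun x hx => ?_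
        obtain ⟨y, hy, rfl⟩ := b1.surjOn hx
        obtain ⟨z, hz, hzy⟩ := b2.surjOn hx
        exact h.eq_zero _ _ _ _ rfl rfl y hy z hz hzy.symm
      rw [this, finrank_bot] at hr
      exact zero_ne_one hr
    · have e0 : staircase p q (2 * c) = (p + c, q - c - 1 + 1) := by
        simp only [staircase, Prod.mk.injEq]; omega
      have e1 : staircase p q (2 * c + 1) = (p + c, q - c - 1) := by
        simp only [staircase, Prod.mk.injEq]; omega
      have e2 : staircase p q (2 * c + 2) = (p + c + 1, q - c - 1) := by
        simp only [staircase, Prod.mk.injEq]; omega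
      have m0 := e0 ▸ mem (2 * c) (by omega) (by omega)
      have m1 := e1 ▸ mem (2 * c + 1) (by omega) (by omega)
      have m2 := e2 ▸ mem (2 * c + 2) (by omega) (by omega)
      exact h.not_injective (hD.finrank_eq_one _ _ m1) (hD.bijOn_d1 _ _ m1 m2).injOn
        (hD.bijOn_d2 _ _ m1 m0).injOn

/-- A piece of a decomposition is a direct summand. -/
theorem IsDecomposition.isSplit {ι : Type} {D : ι → ℤ → ℤ → Submodule K V}
    {S : ι → Set (ℤ × ℤ)} (h : IsDecomposition d1 d2 A D S) (i : ι) :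
    IsSplit d1 d2 A (D i) (fun p q => ⨆ (j) (_ : j ≠ i), D j p q) where
  stable_left := h.stable i
  stable_right := by
    have key : ∀ (d : V →ₗ[K] V) (p q p' q' : ℤ), (∀ j, ∀ a ∈ D j p q, d a ∈ D j p' q') →
        ∀ a ∈ ⨆ (j) (_ : j ≠ i), D j p q, d a ∈ ⨆ (j) (_ : j ≠ i), D j p' q' := by
      intro d p q p' q' hd
      change (⨆ (j) (_ : j ≠ i), D j p q) ≤ (⨆ (j) (_ : j ≠ i), D j p' q').comap d
      refine iSup₂_le fun j hj a ha => ?_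
      exact Submodule.mem_iSup_of_mem j (Submodule.mem_iSup_of_mem hj (hd j a ha))
    exact ⟨fun p q => key d1 p q _ _ fun j => (h.stable j).1 p q,
      fun p q => key d2 p q _ _ fun j => (h.stable j).2 p q⟩
  disjoint p q := h.independent p q i
  sup_eq p q := by rw [← h.iSup_eq, iSup_split_single (fun j => D j p q) i]

theorem IsDecomposition.isDotShape_or_isLineShape {ι : Type} {D : ι → ℤ → ℤ → Submodule K V}
    {S : ι → Set (ℤ × ℤ)} (h : IsDecomposition d1 d2 A D S) (hA : IsShort d1 d2 A) (i : ι) :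
    IsDotShape (S i) ∨ IsLineShape (S i) :=
  (hA.of_isSplit (h.isSplit i)).isDotShape_or_isLineShape (h.hasShape i) (h.elementary i)

/-! #### The `∂∂̄`-Lemma -/

theorem HasShape.eq_zero_of_isDotShape {S : Set (ℤ × ℤ)} (h : HasShape d1 d2 D S)
    (hD : IsStable d1 d2 D) (hS : IsDotShape S) {p q : ℤ} {a : V} (ha : a ∈ D p q) :
    d1 a = 0 ∧ d2 a = 0 := by
  obtain ⟨-, p0, q0, j, rfl⟩ := hS
  have e : Set.Ico j (j + (1 : ℕ)) = {j} := by ext; simp; omega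
  rw [e, Set.image_singleton] at h
  have bot := h.eq_bot
  have key : ∀ p' q', (p' ≠ p ∨ q' ≠ q) → ∀ x ∈ D p' q', a ≠ 0 → x = 0 := by
    intro p' q' hne x hx ha0
    have hpq : (p, q) = staircase p0 q0 j := by
      by_contra hc
      have := bot p q hc
      rw [this] at ha
      exact ha0 ((Submodule.mem_bot K).1 ha)
    have := bot p' q' (by
      rw [← hpq, Set.mem_singleton_iff, Prod.mk.injEq]
      tauto)
    rw [this] at hx
    exact (Submodule.mem_bot K).1 hx
  by_cases ha0 : a = 0
  · simp [ha0]
  · exact ⟨key _ _ (Or.inl (by omega)) _ (hD.1 p q a ha) ha0,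
      key _ _ (Or.inr (by omega)) _ (hD.2 p q a ha) ha0⟩

theorem IsDecomposition.satisfiesDdbarLemma {ι : Type} {D : ι → ℤ → ℤ → Submodule K V}
    {S : ι → Set (ℤ × ℤ)} (h : IsDecomposition d1 d2 A D S) (hS : ∀ i, IsDotShape (S i)) :
    SatisfiesDdbarLemma d1 d2 A := by
  -- With dots only, both differentials vanish, so the sole exact element is 0 and the witness 0
  -- suffices.
  have hle : total A ≤ LinearMap.ker (d1 + d2) := by
    refine iSup₂_le fun p q => ?_
    rw [← h.iSup_eq]
    refine iSup_le fun i a ha => ?_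
    obtain ⟨h1, h2⟩ := (h.hasShape i).eq_zero_of_isDotShape (h.stable i) (hS i) ha
    simp [h1, h2]
  rintro a - - - ⟨b, hb, rfl⟩
  exact ⟨0, zero_mem _, by simpa using (hle hb).symm⟩

/-! #### Existence of decompositions -/

/-- Lets one split summand be added to a decomposition of its complement; modularity is what turns
two-step independence into independence of the whole family. -/
theorem iSupIndep_option {α ι : Type*} [CompleteLattice α] [IsModularLattice α] {t : Option ι → α}
    (h : iSupIndep fun i => t (some i)) (hd : Disjoint (t none) (⨆ i, t (some i))) :
    iSupIndep t := by
  intro i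
  rcases i with _ | i
  · refine hd.mono_right (iSup₂_le fun j hj => ?_)
    rcases j with _ | j
    · exact absurd rfl hj
    · exact le_iSup (fun i => t (some i)) j
  · have h1 : Disjoint (t (some i)) ((⨆ (j) (_ : j ≠ i), t (some j)) ⊔ t none) := by
      refine Disjoint.disjoint_sup_right_of_disjoint_sup_left (h i) (hd.symm.mono_left ?_)
      exact sup_le (le_iSup (fun i => t (some i)) i)
        (iSup₂_le fun j _ => le_iSup (fun i => t (some i)) j)
    refine h1.mono_right (iSup₂_le fun j hj => ?_)
    rcases j with _ | j
    · exact le_sup_right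
    · exact le_sup_of_le_left (le_iSup₂_of_le j (fun e => hj (by rw [e])) le_rfl)

theorem IsSplit.isDecomposition_option {ι : Type} {D' : ι → ℤ → ℤ → Submodule K V}
    {S' : ι → Set (ℤ × ℤ)} {S : Set (ℤ × ℤ)} (hs : IsSplit d1 d2 A D A')
    (hD : HasShape d1 d2 D S) (hS : IsElementaryShape S) (h : IsDecomposition d1 d2 A' D' S') :
    IsDecomposition d1 d2 A (fun i : Option ι => i.elim D D') (fun i => i.elim S S') where
  stable i := by
    rcases i with _ | i
    exacts [hs.stable_left, h.stable i]
  independent p q := iSupIndep_option (h.independent p q) (by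
    simpa only [Option.elim, h.iSup_eq] using hs.disjoint p q)
  iSup_eq p q := by
    rw [iSup_option]
    simpa only [Option.elim, h.iSup_eq] using hs.sup_eq p q
  elementary i := by
    rcases i with _ | i
    exacts [hS, h.elementary i]
  hasShape i := by
    rcases i with _ | i
    exacts [hD, h.hasShape i]

/-- An element that is closed for `d2` and not for `d1` spans, together with its differential, a
direct summand of a short double complex. -/
theorem IsDoubleComplex.exists_isSplit_line (hA : IsDoubleComplex d1 d2 A) (h : IsShort d1 d2 A)
    {p q : ℤ} {u : V} (hu : u ∈ A p q) (h1 : d1 u ≠ 0) (h2 : d2 u = 0) :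
    ∃ D A', IsSplit d1 d2 A D A' ∧ HasShape d1 d2 D {(p, q), (p + 1, q)} := by
  have hu0 : u ≠ 0 := fun e => h1 (by rw [e, map_zero])
  -- Shortness enters here: `d1 u` is not a value of `d2`, so a functional can separate it from that
  -- image. This functional makes the complement below stable.
  have hnot : d1 u ∉ (A (p + 1) (q - 1)).map d2 := by
    rintro ⟨b, hb, e⟩
    exact h1 (h.eq_zero p q _ _ rfl (by ring) u hu b hb e.symm)
  obtain ⟨f, hf, hle⟩ : ∃ f : V →ₗ[K] K, f (d1 u) = 1 ∧
      ∀ b ∈ A (p + 1) (q - 1), f (d2 b) = 0 := by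
    obtain ⟨g, hg, hle⟩ := Submodule.exists_le_ker_of_notMem hnot
    refine ⟨(g (d1 u))⁻¹ • g, ?_, fun b hb => ?_⟩
    · rw [LinearMap.smul_apply, smul_eq_mul, inv_mul_cancel₀ hg]
    · rw [LinearMap.smul_apply, LinearMap.mem_ker.1 (hle ⟨b, hb, rfl⟩), smul_zero]
  set D : ℤ → ℤ → Submodule K V := fun a b => Submodule.span K
    {x | (a = p ∧ b = q ∧ x = u) ∨ (a = p + 1 ∧ b = q ∧ x = d1 u)} with hDdef
  have D0 : D p q = Submodule.span K {u} := by
    simp only [hDdef]; congr 1; ext x; simp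
  have D1 : D (p + 1) q = Submodule.span K {d1 u} := by
    simp only [hDdef]; congr 1; ext x; simp
  have Dbot : ∀ a b, ¬ (a = p ∧ b = q) → ¬ (a = p + 1 ∧ b = q) → D a b = ⊥ := by
    intro a b e1 e2
    rw [Submodule.span_eq_bot]
    rintro x (⟨ha, hb, -⟩ | ⟨ha, hb, -⟩)
    exacts [(e1 ⟨ha, hb⟩).elim, (e2 ⟨ha, hb⟩).elim]
  -- The complement is the kernel of `f ∘ d1` at the source of the line and the kernel of `f` at its
  -- target, and everything elsewhere.
  let A' : ℤ → ℤ → Submodule K V := fun a b =>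
    { carrier := {x | x ∈ A a b ∧ (a = p → b = q → f (d1 x) = 0) ∧ (a = p + 1 → b = q → f x = 0)}
      add_mem' := fun {x y} hx hy => ⟨add_mem hx.1 hy.1,
        fun e1 e2 => by rw [map_add, map_add, hx.2.1 e1 e2, hy.2.1 e1 e2, add_zero],
        fun e1 e2 => by rw [map_add, hx.2.2 e1 e2, hy.2.2 e1 e2, add_zero]⟩
      zero_mem' := ⟨zero_mem _, by simp, by simp⟩
      smul_mem' := fun c x hx => ⟨Submodule.smul_mem _ c hx.1,
        fun e1 e2 => by rw [map_smul, map_smul, hx.2.1 e1 e2, smul_zero],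
        fun e1 e2 => by rw [map_smul, hx.2.2 e1 e2, smul_zero]⟩ }
  have hA' : ∀ a b x, x ∈ A' a b ↔
    x ∈ A a b ∧ (a = p → b = q → f (d1 x) = 0) ∧ (a = p + 1 → b = q → f x = 0) :=
    fun _ _ _ => Iff.rfl
  refine ⟨D, A', ⟨⟨?_, ?_⟩, ⟨?_, ?_⟩, ?_, ?_⟩, ?_, ?_, ?_, ?_⟩
  · intro a b
    change D a b ≤ (D (a + 1) b).comap d1
    refine Submodule.span_le.2 ?_
    rintro x (⟨rfl, rfl, rfl⟩ | ⟨rfl, rfl, rfl⟩)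
    · exact Submodule.subset_span (Or.inr ⟨rfl, rfl, rfl⟩)
    · simp [hA.d1_d1 _ _ _ hu]
  · intro a b
    change D a b ≤ (D a (b + 1)).comap d2
    refine Submodule.span_le.2 ?_
    rintro x (⟨rfl, rfl, rfl⟩ | ⟨rfl, rfl, rfl⟩)
    · simp [h2]
    · have := hA.anticomm _ _ _ hu
      rw [h2, map_zero, zero_add] at this
      simp [this]
  · rintro a b x ⟨hx, hx1, hx2⟩
    refine ⟨hA.stable.1 a b x hx, fun _ _ => ?_, fun e1 e2 => hx1 (by omega) e2⟩
    rw [hA.d1_d1 a b x hx, map_zero]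
  · rintro a b x ⟨hx, hx1, hx2⟩
    refine ⟨hA.stable.2 a b x hx, fun e1 e2 => ?_, fun e1 e2 => ?_⟩
    · have := hA.anticomm a b x hx
      rw [eq_neg_of_add_eq_zero_left this, map_neg, hle, neg_zero]
      subst e1 e2
      simpa using hA.stable.1 a b x hx
    · subst e1 e2
      exact hle x (by simpa using hx)
  · intro a b
    rw [Submodule.disjoint_def]
    rintro x hx ⟨-, hx1, hx2⟩
    by_cases e1 : a = p ∧ b = q
    · obtain ⟨rfl, rfl⟩ := e1
      rw [D0, Submodule.mem_span_singleton] at hx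
      obtain ⟨c, rfl⟩ := hx
      have := hx1 rfl rfl
      rw [map_smul, map_smul, hf, smul_eq_mul, mul_one] at this
      rw [this, zero_smul]
    by_cases e2 : a = p + 1 ∧ b = q
    · obtain ⟨rfl, rfl⟩ := e2
      rw [D1, Submodule.mem_span_singleton] at hx
      obtain ⟨c, rfl⟩ := hx
      have := hx2 rfl rfl
      rw [map_smul, hf, smul_eq_mul, mul_one] at this
      rw [this, zero_smul]
    · rw [Dbot a b e1 e2] at hx
      exact (Submodule.mem_bot K).1 hx
  · intro a b
    refine le_antisymm (sup_le ?_ fun x hx => hx.1) fun x hx => ?_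
    · refine Submodule.span_le.2 ?_
      rintro x (⟨rfl, rfl, rfl⟩ | ⟨rfl, rfl, rfl⟩)
      exacts [hu, hA.stable.1 _ _ _ hu]
    by_cases e1 : a = p ∧ b = q
    · obtain ⟨rfl, rfl⟩ := e1
      refine Submodule.mem_sup.2 ⟨f (d1 x) • u, ?_, x - f (d1 x) • u, ?_, by abel⟩
      · rw [D0]; exact Submodule.smul_mem _ _ (Submodule.mem_span_singleton_self u)
      · refine ⟨sub_mem hx (Submodule.smul_mem _ _ hu), fun _ _ => ?_, fun e => by omega⟩
        simp [hf]
    by_cases e2 : a = p + 1 ∧ b = q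
    · obtain ⟨rfl, rfl⟩ := e2
      refine Submodule.mem_sup.2 ⟨f x • d1 u, ?_, x - f x • d1 u, ?_, by abel⟩
      · rw [D1]; exact Submodule.smul_mem _ _ (Submodule.mem_span_singleton_self _)
      · refine ⟨sub_mem hx (Submodule.smul_mem _ _ (hA.stable.1 _ _ _ hu)),
          fun e => by omega, fun _ _ => ?_⟩
        simp [hf]
    · refine (le_sup_right : A' a b ≤ _) ⟨hx, fun h1 h2 => (e1 ⟨h1, h2⟩).elim,
        fun h1 h2 => (e2 ⟨h1, h2⟩).elim⟩
  · rintro a b hab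
    simp only [Set.mem_insert_iff, Prod.mk.injEq, Set.mem_singleton_iff] at hab
    rcases hab with ⟨rfl, rfl⟩ | ⟨rfl, rfl⟩
    · rw [D0, finrank_span_singleton hu0]
    · rw [D1, finrank_span_singleton h1]
  · intro a b hab
    simp only [Set.mem_insert_iff, Prod.mk.injEq, Set.mem_singleton_iff, not_or] at hab
    exact Dbot a b hab.1 hab.2
  · intro a b hab hab'
    simp only [Set.mem_insert_iff, Prod.mk.injEq, Set.mem_singleton_iff] at hab hab'
    obtain ⟨rfl, rfl⟩ : a = p ∧ b = q := by omega
    rw [D0, D1]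
    refine ⟨?_, ?_, ?_⟩
    · intro x hx
      obtain ⟨c, rfl⟩ := Submodule.mem_span_singleton.1 hx
      exact Submodule.mem_span_singleton.2 ⟨c, (map_smul _ _ _).symm⟩
    · intro x hx y hy hxy
      obtain ⟨c, rfl⟩ := Submodule.mem_span_singleton.1 hx
      obtain ⟨c', rfl⟩ := Submodule.mem_span_singleton.1 hy
      rw [map_smul, map_smul] at hxy
      rw [smul_left_injective K h1 hxy]
    · intro x hx
      obtain ⟨c, rfl⟩ := Submodule.mem_span_singleton.1 hx
      exact ⟨c • u, Submodule.mem_span_singleton.2 ⟨c, rfl⟩, map_smul _ _ _⟩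
  · intro a b hab hab'
    simp only [Set.mem_insert_iff, Prod.mk.injEq, Set.mem_singleton_iff] at hab hab'
    omega

/-- If all differentials vanish, every nonzero element spans a direct summand. -/
theorem exists_isSplit_dot (h1 : ∀ p q, ∀ a ∈ A p q, d1 a = 0) (h2 : ∀ p q, ∀ a ∈ A p q, d2 a = 0)
    {p q : ℤ} {u : V} (hu : u ∈ A p q) (hu0 : u ≠ 0) :
    ∃ D A', IsSplit d1 d2 A D A' ∧ HasShape d1 d2 D {(p, q)} := by
  obtain ⟨f, hf⟩ : ∃ f : V →ₗ[K] K, f u = 1 := by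
    obtain ⟨g, hg, -⟩ := Submodule.exists_le_ker_of_notMem (p := (⊥ : Submodule K V)) (v := u)
      (by simpa using hu0)
    exact ⟨(g u)⁻¹ • g, by rw [LinearMap.smul_apply, smul_eq_mul, inv_mul_cancel₀ hg]⟩
  set D : ℤ → ℤ → Submodule K V := fun a b => Submodule.span K {x | a = p ∧ b = q ∧ x = u}
    with hDdef
  have D0 : D p q = Submodule.span K {u} := by
    simp only [hDdef]; congr 1; ext x; simp
  have Dbot : ∀ a b, ¬ (a = p ∧ b = q) → D a b = ⊥ := by
    intro a b e1
    rw [Submodule.span_eq_bot]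
    rintro x ⟨ha, hb, -⟩
    exact (e1 ⟨ha, hb⟩).elim
  let A' : ℤ → ℤ → Submodule K V := fun a b =>
    { carrier := {x | x ∈ A a b ∧ (a = p → b = q → f x = 0)}
      add_mem' := fun {x y} hx hy => ⟨add_mem hx.1 hy.1,
        fun e1 e2 => by rw [map_add, hx.2 e1 e2, hy.2 e1 e2, add_zero]⟩
      zero_mem' := ⟨zero_mem _, by simp⟩
      smul_mem' := fun c x hx => ⟨Submodule.smul_mem _ c hx.1,
        fun e1 e2 => by rw [map_smul, hx.2 e1 e2, smul_zero]⟩ }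
  have DA : ∀ a b, D a b ≤ A a b := by
    refine fun a b => Submodule.span_le.2 ?_
    rintro x ⟨rfl, rfl, rfl⟩
    exact hu
  refine ⟨D, A', ⟨⟨?_, ?_⟩, ⟨?_, ?_⟩, ?_, ?_⟩, ?_, ?_, ?_, ?_⟩
  · intro a b x hx
    rw [h1 a b x (DA a b hx)]; exact zero_mem _
  · intro a b x hx
    rw [h2 a b x (DA a b hx)]; exact zero_mem _
  · rintro a b x ⟨hx, -⟩
    rw [h1 a b x hx]; exact zero_mem _
  · rintro a b x ⟨hx, -⟩
    rw [h2 a b x hx]; exact zero_mem _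
  · intro a b
    rw [Submodule.disjoint_def]
    rintro x hx ⟨-, hx1⟩
    by_cases e1 : a = p ∧ b = q
    · obtain ⟨rfl, rfl⟩ := e1
      rw [D0, Submodule.mem_span_singleton] at hx
      obtain ⟨c, rfl⟩ := hx
      have := hx1 rfl rfl
      rw [map_smul, hf, smul_eq_mul, mul_one] at this
      rw [this, zero_smul]
    · rw [Dbot a b e1] at hx
      exact (Submodule.mem_bot K).1 hx
  · intro a b
    refine le_antisymm (sup_le (DA a b) fun x hx => hx.1) fun x hx => ?_
    by_cases e1 : a = p ∧ b = q
    · obtain ⟨rfl, rfl⟩ := e1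
      refine Submodule.mem_sup.2 ⟨f x • u, ?_, x - f x • u, ?_, by abel⟩
      · rw [D0]; exact Submodule.smul_mem _ _ (Submodule.mem_span_singleton_self u)
      · refine ⟨sub_mem hx (Submodule.smul_mem _ _ hu), fun _ _ => ?_⟩
        simp [hf]
    · exact (le_sup_right : A' a b ≤ _) ⟨hx, fun h1 h2 => (e1 ⟨h1, h2⟩).elim⟩
  · rintro a b hab
    simp only [Prod.mk.injEq, Set.mem_singleton_iff] at hab
    obtain ⟨rfl, rfl⟩ := hab
    rw [D0, finrank_span_singleton hu0]
  · intro a b hab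
    simp only [Prod.mk.injEq, Set.mem_singleton_iff] at hab
    exact Dbot a b hab
  · intro a b hab hab'
    simp only [Prod.mk.injEq, Set.mem_singleton_iff] at hab hab'
    omega
  · intro a b hab hab'
    simp only [Prod.mk.injEq, Set.mem_singleton_iff] at hab hab'
    omega

/-- A nonzero short double complex has a dot or a line as a direct summand. -/
theorem IsDoubleComplex.exists_isSplit (hA : IsDoubleComplex d1 d2 A) (h : IsShort d1 d2 A)
    {p q : ℤ} (hpq : A p q ≠ ⊥) :
    ∃ D A' S, IsSplit d1 d2 A D A' ∧ HasShape d1 d2 D S ∧ S.Nonempty ∧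
      (IsDotShape S ∨ IsLineShape S) := by
  by_cases h1 : ∀ p q, ∀ a ∈ A p q, d1 a = 0
  · by_cases h2 : ∀ p q, ∀ a ∈ A p q, d2 a = 0
    · obtain ⟨u, hu, hu0⟩ := (Submodule.ne_bot_iff _).1 hpq
      obtain ⟨D, A', hs, hD⟩ := exists_isSplit_dot h1 h2 hu hu0
      exact ⟨D, A', _, hs, hD, by simp, Or.inl (isDotShape_singleton p q)⟩
    · push Not at h2
      obtain ⟨p, q, u, hu, h2⟩ := h2
      obtain ⟨D, A', hs, hD⟩ := hA.swap.exists_isSplit_line h.swap (p := q) (q := p) hu h2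
        (h1 p q u hu)
      refine ⟨_, _, _, hs.swap, hD.swap, ⟨(p, q), by simp⟩, Or.inr ?_⟩
      convert isLineShape_d2 p q using 1
      ext ⟨a, b⟩
      simp only [Set.mem_preimage, Prod.swap_prod_mk, Set.mem_insert_iff, Prod.mk.injEq,
        Set.mem_singleton_iff]
      tauto
  · push Not at h1
    obtain ⟨p, q, u, hu, h1⟩ := h1
    -- Discarding the `d1`-closed component leaves a `d2`-closed element with the same nonzero `d1`.
    obtain ⟨b, hb, c, hc, hb1, hc2, rfl⟩ := h.exists_add p q u hu
    rw [map_add, hb1, zero_add] at h1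
    obtain ⟨D, A', hs, hD⟩ := hA.exists_isSplit_line h hc h1 hc2
    exact ⟨D, A', _, hs, hD, by simp, Or.inr (isLineShape_d1 p q)⟩

/-- A bounded, finite dimensional, short double complex is a finite direct sum of dots and lines. -/
theorem IsDoubleComplex.exists_isDecomposition (hA : IsDoubleComplex d1 d2 A)
    (h : IsShort d1 d2 A) (hfin : ∀ p q, FiniteDimensional K (A p q)) (s : Finset (ℤ × ℤ))
    (hs : ∀ p q, (p, q) ∉ s → A p q = ⊥) :
    ∃ (r : ℕ) (D : Fin r → ℤ → ℤ → Submodule K V) (S : Fin r → Set (ℤ × ℤ)),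
      IsDecomposition d1 d2 A D S ∧ ∀ i, IsDotShape (S i) ∨ IsLineShape (S i) := by
  -- Induction on a bound for the total dimension. An arbitrary finite index type allows each new
  -- summand to be added through `Option`; the reindexing by `Fin r` is done once.
  suffices H : ∀ (N : ℕ) (A : ℤ → ℤ → Submodule K V), IsDoubleComplex d1 d2 A →
      IsShort d1 d2 A → (∀ p q, FiniteDimensional K (A p q)) →
      (∀ p q, (p, q) ∉ s → A p q = ⊥) → ∑ v ∈ s, Module.finrank K (A v.1 v.2) ≤ N →
      ∃ (ι : Type) (_ : Finite ι) (D : ι → ℤ → ℤ → Submodule K V) (S : ι → Set (ℤ × ℤ)),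
        IsDecomposition d1 d2 A D S by
    obtain ⟨ι, _, D, S, hD⟩ := H _ A hA h hfin hs le_rfl
    obtain ⟨r, ⟨e⟩⟩ := Finite.exists_equiv_fin ι
    have hD' : IsDecomposition d1 d2 A (fun i => D (e.symm i)) (fun i => S (e.symm i)) :=
      { stable := fun i => hD.stable _
        independent := fun p q => (hD.independent p q).comp e.symm.injective
        iSup_eq := fun p q => by
          rw [← hD.iSup_eq]; exact e.symm.iSup_comp (g := fun i => D i p q)
        elementary := fun i => hD.elementary _
        hasShape := fun i => hD.hasShape _ }
    exact ⟨r, _, _, hD', hD'.isDotShape_or_isLineShape h⟩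
  intro N
  induction N with
  | zero =>
    intro A hA h hfin hs hN
    have hbot : ∀ p q, A p q = ⊥ := by
      intro p q
      by_cases hpq : (p, q) ∈ s
      · have := hfin p q
        rw [← Submodule.finrank_eq_zero (R := K)]
        exact Finset.sum_eq_zero_iff.1 (Nat.le_zero.1 hN) (p, q) hpq
      · exact hs p q hpq
    exact ⟨Empty, inferInstance, fun i => i.elim, fun i => i.elim,
      { stable := fun i => i.elim
        independent := fun p q i => i.elim
        iSup_eq := fun p q => by rw [iSup_of_empty, hbot]
        elementary := fun i => i.elim
        hasShape := fun i => i.elim }⟩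
  | succ N ih =>
    intro A hA h hfin hs hN
    by_cases hbot : ∀ p q, A p q = ⊥
    · exact ih A hA h hfin hs (by
        rw [Finset.sum_eq_zero fun v _ => by rw [hbot, finrank_bot]]
        exact Nat.zero_le N)
    push Not at hbot
    obtain ⟨p, q, hpq⟩ := hbot
    obtain ⟨D, A', S, hsp, hD, ⟨⟨p0, q0⟩, hv⟩, hS⟩ := hA.exists_isSplit h hpq
    have hle : ∀ p q, A' p q ≤ A p q := hsp.symm.left_le
    -- The summand split off is nonzero at a point of its shape, so the complement has strictly
    -- smaller total dimension.
    have hlt : A' p0 q0 < A p0 q0 := by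
      refine lt_of_le_of_ne (hle p0 q0) fun e => ?_
      have h1 : D p0 q0 = ⊥ := by
        have := hsp.disjoint p0 q0
        rw [e] at this
        exact this.eq_bot_of_le (hsp.left_le p0 q0)
      have := hD.finrank_eq_one p0 q0 hv
      rw [h1, finrank_bot] at this
      exact zero_ne_one this
    have hmem : (p0, q0) ∈ s := by
      by_contra hc
      rw [hs p0 q0 hc] at hlt
      exact not_lt_bot hlt
    obtain ⟨ι, _, D', S', hD'⟩ := ih A' (hA.of_isSplit hsp.symm) (h.of_isSplit hsp.symm)
      (fun p q => have := hfin p q; Submodule.finiteDimensional_of_le (hle p q))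
      (fun p q hpq => le_bot_iff.1 (hs p q hpq ▸ hle p q)) (by
        have : ∑ v ∈ s, Module.finrank K (A' v.1 v.2) < ∑ v ∈ s, Module.finrank K (A v.1 v.2) :=
          Finset.sum_lt_sum
            (fun v _ => have := hfin v.1 v.2; Submodule.finrank_mono (hle v.1 v.2))
            ⟨(p0, q0), hmem, have := hfin p0 q0; Submodule.finrank_lt_finrank_of_lt hlt⟩
        omega)
    refine ⟨Option ι, inferInstance, _, _, hsp.isDecomposition_option hD ?_ hD'⟩
    rcases hS with hS | hS
    exacts [Or.inr ⟨1, hS⟩, Or.inr ⟨2, hS⟩]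

end DoubleComplex

end

/-! ### Degeneration at page 2 and purity for short double complexes. -/

noncomputable section

namespace DoubleComplex

variable {K V : Type*} [Field K] [AddCommGroup V] [Module K V]
  {d1 d2 : V →ₗ[K] V} {A : ℤ → ℤ → Submodule K V}

/-! #### Spectral sequence and Hodge filtration of short double complexes -/

/-- The part of total degree `k` and of first degrees in `s`. -/
def degSum (A : ℤ → ℤ → Submodule K V) (k : ℤ) (s : Set ℤ) : Submodule K V :=
  ⨆ p ∈ s, A p (k - p)

theorem le_degSum {k p : ℤ} {s : Set ℤ} (hp : p ∈ s) : A p (k - p) ≤ degSum A k s :=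
  le_iSup₂_of_le p hp le_rfl

theorem degSum_mono {k : ℤ} {s t : Set ℤ} (h : s ⊆ t) : degSum A k s ≤ degSum A k t :=
  biSup_mono h

theorem degSum_union (k : ℤ) (s t : Set ℤ) :
    degSum A k (s ∪ t) = degSum A k s ⊔ degSum A k t := iSup_union

theorem degSum_singleton (k p : ℤ) : degSum A k {p} = A p (k - p) := iSup_singleton

theorem filt_eq_degSum (p k : ℤ) : filt A p k = degSum A k (Set.Ici p) := rfl

theorem tot_eq_degSum (k : ℤ) : tot A k = degSum A k Set.univ := by
  simp [tot, degSum]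

/-- In total degree `k`, second degree at least `p` means first degree at most `k - p`. Both
filtrations thus become sums over sets of first degrees and can be compared. -/
theorem filt_swap_eq_degSum (p k : ℤ) : filt (swap A) p k = degSum A k (Set.Iic (k - p)) := by
  refine le_antisymm (iSup₂_le fun p' hp' => ?_) (iSup₂_le fun p' hp' => ?_)
  · have : swap A p' (k - p') = A (k - p') (k - (k - p')) := by simp [swap]
    rw [this]
    exact le_degSum (show k - p' ≤ k - p by omega)
  · have : A p' (k - p') = swap A (k - p') (k - (k - p')) := by simp [swap]
    rw [this]
    exact le_iSup₂_of_le (f := fun p' (_ : p ≤ p') => swap A p' (k - p')) (k - p')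
      (by have : p' ≤ k - p := hp'
          omega) le_rfl

theorem IsDoubleComplex.disjoint_degSum (hA : IsDoubleComplex d1 d2 A) (k : ℤ) {s t : Set ℤ}
    (h : Disjoint s t) : Disjoint (degSum A k s) (degSum A k t) :=
  (hA.independent.comp (f := fun p : ℤ => ((p, k - p) : ℤ × ℤ))
    fun _ _ hpq => congrArg Prod.fst hpq).disjoint_biSup_biSup h

theorem IsDoubleComplex.eq_zero_of_mem (hA : IsDoubleComplex d1 d2 A) {k : ℤ} {s t : Set ℤ}
    (h : Disjoint s t) {x : V} (hx : x ∈ degSum A k s) (hx' : x ∈ degSum A k t) : x = 0 :=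
  Submodule.disjoint_def.1 (hA.disjoint_degSum k h) x hx hx'

theorem IsStable.d1_mem (hA : IsStable d1 d2 A) {p k : ℤ} {x : V} (hx : x ∈ A p (k - p)) :
    d1 x ∈ A (p + 1) (k + 1 - (p + 1)) := by
  rw [add_sub_add_right_eq_sub]; exact hA.1 _ _ x hx

theorem IsStable.d2_mem (hA : IsStable d1 d2 A) {p k : ℤ} {x : V} (hx : x ∈ A p (k - p)) :
    d2 x ∈ A p (k + 1 - p) := by
  rw [add_sub_right_comm]; exact hA.2 _ _ x hx

theorem IsStable.degSum_le (hA : IsStable d1 d2 A) {k : ℤ} {s t : Set ℤ}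
    (h : ∀ p ∈ s, p ∈ t ∧ p + 1 ∈ t) {x : V} (hx : x ∈ degSum A k s) :
    (d1 + d2) x ∈ degSum A (k + 1) t := by
  have : degSum A k s ≤ (degSum A (k + 1) t).comap (d1 + d2) := by
    refine iSup₂_le fun p hp y hy => ?_
    exact add_mem (le_degSum (h p hp).2 (hA.d1_mem hy)) (le_degSum (h p hp).1 (hA.d2_mem hy))
  exact this hx

theorem exists_add_of_mem_degSum {k p : ℤ} {s t : Set ℤ} (hst : s = {p} ∪ t) {x : V}
    (hx : x ∈ degSum A k s) : ∃ y ∈ A p (k - p), ∃ z ∈ degSum A k t, y + z = x := by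
  rw [hst, degSum_union, degSum_singleton] at hx
  exact Submodule.mem_sup.1 hx

/-- The leading term of the differential on the filtration by the first degree. -/
theorem IsStable.exists_eq_d2_add (hA : IsStable d1 d2 A) {p k : ℤ} {x : V}
    (hx : x ∈ degSum A k (Set.Ici p)) :
    ∃ y ∈ A p (k - p), ∃ r ∈ degSum A (k + 1) (Set.Ici (p + 1)), (d1 + d2) x = d2 y + r := by
  obtain ⟨y, hy, z, hz, rfl⟩ := exists_add_of_mem_degSum (p := p) (t := Set.Ici (p + 1))
    (by ext; simp; omega) hx
  refine ⟨y, hy, d1 y + (d1 + d2) z, add_mem (le_degSum (by simp) (hA.d1_mem hy))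
    (hA.degSum_le ?_ hz), ?_⟩
  · intro q hq; simp at hq ⊢; omega
  · simp only [LinearMap.add_apply, map_add]; abel

/-- The leading term of the differential on the filtration by the second degree. -/
theorem IsStable.exists_eq_d1_add (hA : IsStable d1 d2 A) {p k : ℤ} {x : V}
    (hx : x ∈ degSum A k (Set.Iic p)) :
    ∃ y ∈ A p (k - p), ∃ r ∈ degSum A (k + 1) (Set.Iic p), (d1 + d2) x = d1 y + r := by
  obtain ⟨y, hy, z, hz, rfl⟩ := exists_add_of_mem_degSum (p := p) (t := Set.Iic (p - 1))
    (by ext; simp; omega) hx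
  refine ⟨y, hy, d2 y + (d1 + d2) z, add_mem (le_degSum (by simp) (hA.d2_mem hy))
    (hA.degSum_le ?_ hz), ?_⟩
  · intro q hq; simp at hq ⊢; omega
  · simp only [LinearMap.add_apply, map_add]; abel

/-- The leading component of an approximate cycle turns out to be closed for both operators, so
removing it does not change the differential and raises the filtration by one. -/
theorem IsDoubleComplex.degeneratesAt_two (hA : IsDoubleComplex d1 d2 A) (h : IsShort d1 d2 A) :
    DegeneratesAt d1 d2 A 2 := by
  rintro r hr p k a ⟨ha, hda⟩
  have ha' : a ∈ degSum A k (Set.Ici p) := ha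
  -- Here `2 ≤ r` is used: the components of the differential in first degrees `p` and `p + 1` both
  -- vanish.
  have hda' : (d1 + d2) a ∈ degSum A (k + 1) (Set.Ici (p + 2)) :=
    degSum_mono (Set.Ici_subset_Ici.2 (by omega)) hda
  obtain ⟨y, hy, z, hz, rfl⟩ := exists_add_of_mem_degSum (p := p) (t := Set.Ici (p + 1))
    (by ext; simp; omega) ha'
  obtain ⟨w, hw, t, ht, hzw⟩ := hA.stable.exists_eq_d2_add hz
  have h2 : d2 y = 0 := by
    refine hA.eq_zero_of_mem (s := {p}) (t := Set.Ici (p + 1)) (by simp)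
      (le_degSum (Set.mem_singleton _) (hA.stable.d2_mem hy)) ?_
    have : d2 y = (d1 + d2) (y + z) - d1 y - (d1 + d2) z := by
      simp only [LinearMap.add_apply, map_add]; abel
    rw [this]
    refine sub_mem (sub_mem (degSum_mono (Set.Ici_subset_Ici.2 (by omega)) hda')
      (le_degSum (by simp) (hA.stable.d1_mem hy))) (hA.stable.degSum_le (fun q hq => ?_) hz)
    · simp at hq ⊢; omega
  have h12 : d1 y + d2 w = 0 := by
    refine hA.eq_zero_of_mem (s := {p + 1}) (t := Set.Ici (p + 2)) (by simp)
      (add_mem (le_degSum (Set.mem_singleton _) (hA.stable.d1_mem hy))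
        (le_degSum (Set.mem_singleton _) (hA.stable.d2_mem hw))) ?_
    have : d1 y + d2 w = (d1 + d2) (y + z) - t := by
      rw [map_add, hzw, LinearMap.add_apply, h2]; abel
    rw [this]
    exact sub_mem hda' (by rwa [add_assoc] at ht)
  have h1 : d1 y = 0 := by
    refine h.eq_zero p (k - p) (p + 1) (k - (p + 1)) rfl (by ring) y hy (-w) (neg_mem hw) ?_
    rw [map_neg]
    exact eq_neg_of_add_eq_zero_left h12
  have hyz : (d1 + d2) (y + z) = (d1 + d2) z := by
    rw [map_add, LinearMap.add_apply, h1, h2]; abel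
  replace hda : (d1 + d2) (y + z) ∈ filt A (p + r) (k + 1) := hda
  rw [hyz] at hda ⊢
  -- The differential of `z` lies in the second summand of the denominator, `d Z_{r-1}^{p+1}`.
  refine (le_sup_right : _ ≤ pageDenominator (d1 + d2) A r (p + r) (k + 1)) ⟨z, ⟨?_, ?_⟩, rfl⟩
  · have e1 : p + r - r + 1 = p + 1 := by ring
    have e2 : k + 1 - 1 = k := by ring
    rw [e1, e2]
    exact hz
  · have e1 : p + r - r + 1 + (r - 1) = p + r := by ring
    have e2 : k + 1 - 1 + 1 = k + 1 := by ring
    rw [e1, e2]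
    exact hda

theorem mem_classesIn {d : V →ₗ[K] V} {k : ℤ} {F : Submodule K V} {x : cocycles d A k}
    (hx : (x : V) ∈ F) :
    ((coboundaries d A k).submoduleOf (cocycles d A k)).mkQ x ∈ classesIn d A k F :=
  ⟨x, hx, rfl⟩

/-- Elements are cut between first degrees `p - 1` and `p`. The only interaction across the cut is a
`d1` out of degree `p - 1`, and shortness controls it. -/
theorem IsDoubleComplex.hodgeFiltrationIsPure (hA : IsDoubleComplex d1 d2 A)
    (h : IsShort d1 d2 A) : HodgeFiltrationIsPure d1 d2 A := by
  intro k p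
  have huniv : (Set.univ : Set ℤ) = Set.Ici p ∪ Set.Iic (p - 1) := by ext; simp; omega
  have ek : k - (k + 1 - p) = p - 1 := by ring
  rw [filt_eq_degSum, filt_swap_eq_degSum, ek]
  constructor
  · rw [Submodule.disjoint_def]
    rintro _ ⟨⟨x, hxk, hx0⟩, hx, rfl⟩ ⟨⟨y, hyk, hy0⟩, hy, hxy⟩
    replace hx : x ∈ degSum A k (Set.Ici p) := hx
    replace hy : y ∈ degSum A k (Set.Iic (p - 1)) := hy
    obtain ⟨c, hc, hcyx⟩ : y - x ∈ coboundaries (d1 + d2) A k := by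
      exact (Submodule.Quotient.eq ((coboundaries (d1 + d2) A k).submoduleOf
        (cocycles (d1 + d2) A k))).1 hxy
    refine (Submodule.Quotient.mk_eq_zero _).2 ?_
    change x ∈ coboundaries (d1 + d2) A k
    rw [SetLike.mem_coe, tot_eq_degSum, huniv, degSum_union] at hc
    obtain ⟨c1, hc1, c2, hc2, rfl⟩ := Submodule.mem_sup.1 hc
    obtain ⟨w, hw, s, hs, hws⟩ := hA.stable.exists_eq_d1_add hc2
    -- Only the `d2`-closed component `e` of the leading term crosses the cut, and it contributes
    -- nothing but `d1 e`; hence `-(c1 + e)` is a primitive of `x`.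
    obtain ⟨b, hb, e, he, hb1, he2, rfl⟩ := h.exists_add _ _ w hw
    have hd1 := hA.stable.degSum_le (t := Set.Ici p) (fun q hq => by simp at hq ⊢; omega) hc1
    have hew := hA.stable.d1_mem he
    rw [sub_add_cancel] at hew hd1 hs
    rw [sub_add_cancel] at hew
    have key : x + (d1 + d2) c1 + d1 e = 0 := by
      refine hA.eq_zero_of_mem (s := Set.Ici p) (t := Set.Iic (p - 1))
        (Set.disjoint_left.2 fun q hq hq' => by simp at hq hq'; omega)
        (add_mem (add_mem hx hd1) (le_degSum (by simp) hew)) ?_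
      have : x + (d1 + d2) c1 + d1 e = y - s := by
        rw [map_add, hws, map_add, hb1, zero_add] at hcyx
        rw [← sub_eq_zero] at hcyx ⊢
        rw [← hcyx]; abel
      rw [this]
      exact sub_mem hy hs
    refine ⟨-(c1 + e), neg_mem (add_mem ?_ ?_), ?_⟩
    · rw [tot_eq_degSum]; exact degSum_mono (Set.subset_univ _) hc1
    · rw [tot_eq_degSum]; exact le_degSum (Set.mem_univ (p - 1)) he
    · have : (d1 + d2) e = d1 e := by rw [LinearMap.add_apply, he2, add_zero]
      rw [map_neg, map_add, this, neg_eq_iff_add_eq_zero, ← key]; abel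
  · rw [codisjoint_iff, eq_top_iff]
    rintro z -
    obtain ⟨⟨a, hak, ha0⟩, rfl⟩ := Submodule.mkQ_surjective _ z
    have hak' := hak
    rw [tot_eq_degSum, huniv, degSum_union] at hak'
    obtain ⟨x, hx, y, hy, rfl⟩ := Submodule.mem_sup.1 hak'
    obtain ⟨u, hu, r, hr, hxr⟩ := hA.stable.exists_eq_d2_add hx
    obtain ⟨w, hw, s, hs, hys⟩ := hA.stable.exists_eq_d1_add hy
    have hxy : (d1 + d2) x + (d1 + d2) y = 0 := by
      rw [← map_add]; exact ha0
    have hdw := hA.stable.d1_mem hw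
    rw [sub_add_cancel] at hdw
    have hdu := hA.stable.d2_mem hu
    have hr0 : r = 0 := by
      refine hA.eq_zero_of_mem (s := Set.Ici (p + 1)) (t := Set.Iic p)
        (Set.disjoint_left.2 fun q hq hq' => by simp at hq hq'; omega) hr ?_
      have : r = -(d2 u + d1 w + s) := by
        rw [hxr, hys] at hxy
        rw [← sub_eq_zero, ← hxy]; abel
      rw [this]
      refine neg_mem (add_mem (add_mem (le_degSum (by simp) hdu) (le_degSum (by simp) hdw))
        (degSum_mono ?_ hs))
      intro q hq; simp at hq ⊢; omega
    have hs0 : s = 0 := by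
      refine hA.eq_zero_of_mem (s := Set.Iic (p - 1)) (t := {p}) (by simp) hs ?_
      have : s = -(d2 u + d1 w) := by
        rw [hxr, hys, hr0] at hxy
        rw [← sub_eq_zero, ← hxy]; abel
      rw [this]
      exact neg_mem (add_mem (le_degSum (Set.mem_singleton _) hdu)
        (le_degSum (Set.mem_singleton _) hdw))
    rw [hr0, add_zero] at hxr
    rw [hs0, add_zero] at hys
    -- What remains of the closedness of `x + y` is `d1 w = d2 (-u)`; shortness makes it vanish, so
    -- `x` and `y` are closed separately.
    have hw0 : d1 w = 0 := by
      refine h.eq_zero (p - 1) (k - (p - 1)) p (k - p) (by ring) (by ring) w hw (-u) (neg_mem hu) ?_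
      rw [map_neg, eq_neg_iff_add_eq_zero, ← hxy, hxr, hys, add_comm]
    rw [hw0] at hys
    have hx0 : (d1 + d2) x = 0 := by rwa [hys, add_zero] at hxy
    have hxk : x ∈ tot A k := by
      rw [tot_eq_degSum]; exact degSum_mono (Set.subset_univ _) hx
    have hyk : y ∈ tot A k := by
      rw [tot_eq_degSum]; exact degSum_mono (Set.subset_univ _) hy
    exact Submodule.mem_sup.2 ⟨_, mem_classesIn (x := ⟨x, hxk, hx0⟩) hx,
      _, mem_classesIn (x := ⟨y, hyk, hys⟩) hy, rfl⟩

theorem IsDoubleComplex.hasPageOneDdbarProperty (hA : IsDoubleComplex d1 d2 A)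
    (h : IsShort d1 d2 A) : HasPageOneDdbarProperty d1 d2 A where
  degenerates := hA.degeneratesAt_two h
  degenerates_conj := hA.swap.degeneratesAt_two h.swap
  pure := hA.hodgeFiltrationIsPure h

end DoubleComplex

end

/-! ### Exponential forms, conjugation, and eigenspaces for characters and types. -/

noncomputable section

namespace Forms

open ContinuousAlternatingMap

variable {n m : ℕ}

/-! ### Exterior multiplication by a constant `1`-form -/

/-- The exterior product `θ ∧ η`, for a `1`-form `θ`. -/
def ext (θ : Coord n m →L[ℝ] ℂ) {k : ℕ} (η : Coord n m [⋀^Fin k]→L[ℝ] ℂ) :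
    Coord n m [⋀^Fin (k + 1)]→L[ℝ] ℂ :=
  alternatizeUncurryFin (θ.smulRight η)

theorem ext_apply (θ : Coord n m →L[ℝ] ℂ) {k : ℕ} (η : Coord n m [⋀^Fin k]→L[ℝ] ℂ)
    (v : Fin (k + 1) → Coord n m) :
    ext θ η v = ∑ i : Fin (k + 1), (-1) ^ (i : ℕ) • (θ (v i) * η (i.removeNth v)) := by
  simp [ext, alternatizeUncurryFin_apply]

theorem ext_add_left (θ θ' : Coord n m →L[ℝ] ℂ) {k : ℕ} (η : Coord n m [⋀^Fin k]→L[ℝ] ℂ) :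
    ext (θ + θ') η = ext θ η + ext θ' η := by
  ext v
  simp [ext_apply, add_mul, Finset.sum_add_distrib]

theorem ext_smul_left (c : ℂ) (θ : Coord n m →L[ℝ] ℂ) {k : ℕ}
    (η : Coord n m [⋀^Fin k]→L[ℝ] ℂ) : ext (c • θ) η = c • ext θ η := by
  ext v
  simp only [ext_apply, _root_.smul_apply, ContinuousAlternatingMap.smul_apply, smul_eq_mul,
    Finset.mul_sum, mul_assoc, mul_smul_comm]

theorem ext_add (θ : Coord n m →L[ℝ] ℂ) {k : ℕ} (η η' : Coord n m [⋀^Fin k]→L[ℝ] ℂ) :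
    ext θ (η + η') = ext θ η + ext θ η' := by
  ext v
  simp [ext_apply, mul_add, Finset.sum_add_distrib]

theorem ext_smul (c : ℂ) (θ : Coord n m →L[ℝ] ℂ) {k : ℕ}
    (η : Coord n m [⋀^Fin k]→L[ℝ] ℂ) : ext θ (c • η) = c • ext θ η := by
  ext v
  simp only [ext_apply, ContinuousAlternatingMap.smul_apply,
    smul_eq_mul, Finset.mul_sum, mul_left_comm _ c, mul_smul_comm]

/-- The bilinear map with values `θ x * θ y` times `η` is symmetric, and alternating twice kills
symmetric maps. -/
theorem ext_self (θ : Coord n m →L[ℝ] ℂ) {k : ℕ} (η : Coord n m [⋀^Fin k]→L[ℝ] ℂ) :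
    ext θ (ext θ η) = 0 := by
  let f : Coord n m →ₗ[ℝ] Coord n m →ₗ[ℝ] Coord n m [⋀^Fin k]→ₗ[ℝ] ℂ :=
    LinearMap.mk₂ ℝ (fun x y => (θ x * θ y) • η.toAlternatingMap)
      (fun x y z => by ext v; simp; ring) (fun c x y => by ext v; simp; ring)
      (fun x y z => by ext v; simp; ring) (fun c x y => by ext v; simp; ring)
  have h := AlternatingMap.alternatizeUncurryFin_alternatizeUncurryFinLM_comp_of_symmetric (f := f)
    fun x y => by simp [f, mul_comm]
  ext v
  refine Eq.trans ?_ (congrArg (fun g : Coord n m [⋀^Fin (k + 2)]→ₗ[ℝ] ℂ => g v) h)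
  simp only [ext_apply, AlternatingMap.alternatizeUncurryFin_apply, LinearMap.comp_apply,
    AlternatingMap.alternatizeUncurryFinLM_apply, f, LinearMap.mk₂_apply,
    Finset.mul_sum]
  refine Finset.sum_congr rfl fun i _ => congrArg _ (Finset.sum_congr rfl fun j _ => ?_)
  rw [mul_smul_comm, ← mul_assoc]
  rfl

theorem ext_compContinuousLinearMap (θ : Coord n m →L[ℝ] ℂ) {k : ℕ}
    (η : Coord n m [⋀^Fin k]→L[ℝ] ℂ) (f : Coord n m →L[ℝ] Coord n m) :
    (ext θ η).compContinuousLinearMap f = ext (θ.comp f) (η.compContinuousLinearMap f) := by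
  ext v
  simp only [ext_apply, compContinuousLinearMap_apply, ContinuousLinearMap.comp_apply,
    Function.comp_apply]
  rfl

theorem ext_zero (θ : Coord n m →L[ℝ] ℂ) {k : ℕ} :
    ext θ (0 : Coord n m [⋀^Fin k]→L[ℝ] ℂ) = 0 := by
  ext v
  simp [ext_apply]

theorem wedge_apply (l : List (Coord n m →L[ℝ] ℂ)) (v : Fin l.length → Coord n m) :
    wedge l v = (Matrix.of fun i j => l.get j (v i)).det := by
  simp [wedge, ContinuousMultilinearMap.alternatization_apply_apply, Matrix.det_apply]

/-- Laplace expansion of the determinant along the column of the first factor. -/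
theorem wedge_cons (θ : Coord n m →L[ℝ] ℂ) (l : List (Coord n m →L[ℝ] ℂ)) :
    wedge (θ :: l) = ext θ (wedge l) := by
  ext v
  rw [ext_apply, wedge_apply]
  refine (Matrix.det_succ_column_zero (n := l.length) _).trans ?_
  refine Finset.sum_congr rfl fun i _ => ?_
  rw [wedge_apply, mul_assoc, zsmul_eq_mul]
  push_cast
  rfl

/-! ### Families of constant forms -/

/-- Constant coefficient forms, given by their components in all degrees. -/
abbrev Const (n m : ℕ) : Type := (k : ℕ) → Coord n m [⋀^Fin k]→L[ℝ] ℂ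

theorem smul_zero_alternating (c : ℂ) (k : ℕ) : c • (0 : Coord n m [⋀^Fin k]→L[ℝ] ℂ) = 0 :=
  smul_zero (A := Coord n m [⋀^Fin k]→L[ℝ] ℂ) c

theorem smul_zero_const (c : ℂ) : c • (0 : Const n m) = 0 := smul_zero (A := Const n m) c

theorem neg_one_smul_const (w : Const n m) : (-1 : ℂ) • w = -w := neg_one_smul ℂ w

/-- The exterior product by a `1`-form, in all degrees. -/
def extAll (θ : Coord n m →L[ℝ] ℂ) : Const n m →ₗ[ℂ] Const n m where
  toFun w k := match k with
    | 0 => 0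
    | k + 1 => ext θ (w k)
  map_add' w w' := by
    funext k
    cases k with
    | zero => exact (add_zero _).symm
    | succ k => exact ext_add θ _ _
  map_smul' c w := by
    funext k
    cases k with
    | zero => exact (smul_zero_alternating _ _).symm
    | succ k => exact ext_smul c θ _

theorem extAll_zero_apply (θ : Coord n m →L[ℝ] ℂ) (w : Const n m) : extAll θ w 0 = 0 := rfl

theorem extAll_succ_apply (θ : Coord n m →L[ℝ] ℂ) (w : Const n m) (k : ℕ) :
    extAll θ w (k + 1) = ext θ (w k) := rfl

theorem extAll_add_left (θ θ' : Coord n m →L[ℝ] ℂ) (w : Const n m) :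
    extAll (θ + θ') w = extAll θ w + extAll θ' w := by
  funext k
  cases k with
  | zero => exact (add_zero _).symm
  | succ k => exact ext_add_left θ θ' _

theorem extAll_zero_left (w : Const n m) : extAll 0 w = 0 := by
  have h := extAll_add_left 0 0 w
  rw [add_zero, right_eq_add] at h
  exact h

theorem extAll_smul_left (c : ℂ) (θ : Coord n m →L[ℝ] ℂ) (w : Const n m) :
    extAll (c • θ) w = c • extAll θ w := by
  funext k
  cases k with
  | zero => exact (smul_zero_alternating _ _).symm
  | succ k => exact ext_smul_left c θ _

theorem extAll_sum_left {ι : Type*} (s : Finset ι) (θ : ι → Coord n m →L[ℝ] ℂ) (w : Const n m) :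
    extAll (∑ i ∈ s, θ i) w = ∑ i ∈ s, extAll (θ i) w := by
  induction s using Finset.cons_induction with
  | empty => exact extAll_zero_left w
  | cons i s hi ih => rw [Finset.sum_cons, Finset.sum_cons, extAll_add_left, ih]

theorem extAll_self (θ : Coord n m →L[ℝ] ℂ) (w : Const n m) : extAll θ (extAll θ w) = 0 := by
  funext k
  rcases k with _ | _ | k
  · rfl
  · exact ext_zero θ
  · exact ext_self θ _

/-- Polarization of `extAll_self`. -/
theorem extAll_comm (θ θ' : Coord n m →L[ℝ] ℂ) (w : Const n m) :
    extAll θ (extAll θ' w) = -extAll θ' (extAll θ w) := by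
  have h := extAll_self (θ + θ') w
  simp only [extAll_add_left, map_add, extAll_self, zero_add, add_zero] at h
  exact eq_neg_of_add_eq_zero_right h

/-- The wedge product of a list of `1`-forms, as a family of forms of all degrees. -/
def wedgeAll (l : List (Coord n m →L[ℝ] ℂ)) : Const n m := inDegree (wedge l)

theorem wedgeAll_cons (θ : Coord n m →L[ℝ] ℂ) (l : List (Coord n m →L[ℝ] ℂ)) :
    wedgeAll (θ :: l) = extAll θ (wedgeAll l) := by
  funext k
  cases k with
  | zero => exact Pi.single_eq_of_ne (Nat.succ_ne_zero l.length).symm (wedge (θ :: l))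
  | succ k =>
    rw [extAll_succ_apply]
    by_cases hk : k = l.length
    · subst hk
      rw [wedgeAll, wedgeAll, inDegree, inDegree, Pi.single_eq_same, ← wedge_cons]
      exact Pi.single_eq_same (M := fun k => Coord n m [⋀^Fin k]→L[ℝ] ℂ) (l.length + 1)
        (wedge (θ :: l))
    · have h0 : wedgeAll l k = 0 := Pi.single_eq_of_ne hk _
      rw [h0]
      have h1 : wedgeAll (θ :: l) (k + 1) = 0 :=
        Pi.single_eq_of_ne (fun e => hk (Nat.succ_injective e)) _
      rw [h1, ext_zero]

/-- The scalar is a sign, but only its existence matters, since it is used for membership in spans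
and for vanishing. -/
theorem wedgeAll_perm {l l' : List (Coord n m →L[ℝ] ℂ)} (h : l.Perm l') :
    ∃ c : ℂ, wedgeAll l = c • wedgeAll l' := by
  induction h with
  | nil => exact ⟨1, (one_smul _ _).symm⟩
  | cons θ _ ih =>
    obtain ⟨c, hc⟩ := ih
    exact ⟨c, by rw [wedgeAll_cons, wedgeAll_cons, hc, map_smul]⟩
  | swap θ θ' l =>
    exact ⟨-1, by rw [wedgeAll_cons, wedgeAll_cons, wedgeAll_cons, wedgeAll_cons, extAll_comm,
      neg_one_smul_const]⟩
  | trans _ _ ih ih' =>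
    obtain ⟨c, hc⟩ := ih
    obtain ⟨c', hc'⟩ := ih'
    exact ⟨c * c', by rw [hc, hc', smul_smul]⟩

theorem extAll_wedgeAll_of_mem {θ : Coord n m →L[ℝ] ℂ} {l : List (Coord n m →L[ℝ] ℂ)}
    (h : θ ∈ l) : extAll θ (wedgeAll l) = 0 := by
  classical
  obtain ⟨c, hc⟩ := wedgeAll_perm (List.perm_cons_erase h)
  rw [hc, map_smul, wedgeAll_cons, extAll_self, smul_zero_const]

/-- If a real linear map multiplies the `1`-forms of a list by scalars, it multiplies their wedge
product by the product of the scalars. -/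
theorem wedgeAll_map_compContinuousLinearMap {ι : Type*} (θ : ι → Coord n m →L[ℝ] ℂ) (μ : ι → ℂ)
    (f : Coord n m →L[ℝ] Coord n m) (h : ∀ i, (θ i).comp f = μ i • θ i) (l : List ι) (k : ℕ) :
    (wedgeAll (l.map θ) k).compContinuousLinearMap f =
      (l.map μ).prod • wedgeAll (l.map θ) k := by
  induction l generalizing k with
  | nil =>
    cases k with
    | zero =>
      ext v
      simp only [List.map_nil, List.prod_nil, one_smul, compContinuousLinearMap_apply]
      have : f ∘ v = v := Subsingleton.elim _ _
      rw [this]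
    | succ k =>
      have : wedgeAll ([] : List (Coord n m →L[ℝ] ℂ)) (k + 1) = 0 :=
        Pi.single_eq_of_ne (Nat.succ_ne_zero k) (wedge [])
      simp only [List.map_nil, this, smul_zero_alternating]
      rfl
  | cons i l ih =>
    rw [List.map_cons, List.map_cons, List.prod_cons, wedgeAll_cons]
    cases k with
    | zero =>
      rw [extAll_zero_apply, smul_zero_alternating]
      rfl
    | succ k =>
      rw [extAll_succ_apply, ext_compContinuousLinearMap, h, ih, ext_smul, ext_smul_left,
        smul_smul, mul_comm]

/-! ### Forms with exponential coefficients -/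

/-- A complex linear function on `ℂⁿ`, as a constant `1`-form. -/
def baseForm (lam : (Fin n → ℂ) →L[ℂ] ℂ) : Coord n m →L[ℝ] ℂ :=
  (lam.restrictScalars ℝ).comp (ContinuousLinearMap.fst ℝ (Fin n → ℂ) (Fin m → ℂ))

theorem baseForm_apply (lam : (Fin n → ℂ) →L[ℂ] ℂ) (x : Coord n m) : baseForm lam x = lam x.1 :=
  rfl

theorem hasFDerivAt_exp_smul (lam : (Fin n → ℂ) →L[ℂ] ℂ) {k : ℕ} (w : Coord n m [⋀^Fin k]→L[ℝ] ℂ)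
    (x : Coord n m) :
    HasFDerivAt (fun x : Coord n m => Complex.exp (lam x.1) • w)
      ((Complex.exp (lam x.1) • baseForm lam).smulRight w) x := by
  have h : HasFDerivAt (fun x : Coord n m => baseForm lam x) (baseForm lam) x :=
    (baseForm (m := m) lam).hasFDerivAt
  exact h.cexp.smul_const w

theorem contDiff_exp_smul (lam : (Fin n → ℂ) →L[ℂ] ℂ) {k : ℕ} (w : Coord n m [⋀^Fin k]→L[ℝ] ℂ) :
    ContDiff ℝ ((⊤ : ℕ∞) : WithTop ℕ∞) (fun x : Coord n m => Complex.exp (lam x.1) • w) := by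
  have h : ContDiff ℝ ((⊤ : ℕ∞) : WithTop ℕ∞) (fun x : Coord n m => baseForm lam x) :=
    (baseForm (m := m) lam).contDiff
  exact h.cexp.smul contDiff_const

/-- The form `exp(λ(z)) w` with `λ` linear and `w` constant. -/
def expForm (lam : (Fin n → ℂ) →L[ℂ] ℂ) : Const n m →ₗ[ℂ] AllForms n m where
  toFun w k := ⟨fun x => Complex.exp (lam x.1) • w k, contDiff_exp_smul lam (w k)⟩
  map_add' w w' := by
    funext k
    ext1
    funext x
    exact smul_add _ _ _
  map_smul' c w := by
    funext k
    ext1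
    funext x
    exact smul_comm _ c _

/-- The derivative of exp λ is complex linear, so its linear part is everything and its antilinear
part is zero; the factor `(1 + ε) / 2` records both cases. -/
theorem partialDeriv_expForm (ε : ℂ) (lam : (Fin n → ℂ) →L[ℂ] ℂ) (w : Const n m) (k : ℕ)
    (x : Coord n m) : partialDeriv ε (expForm lam w k).1 x =
      ((1 + ε) / 2) • Complex.exp (lam x.1) • ext (baseForm lam) (w k) := by
  have h : fderiv ℝ (expForm lam w k).1 x =
      (Complex.exp (lam x.1) • baseForm lam).smulRight (w k) :=
    (hasFDerivAt_exp_smul lam (w k) x).fderiv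
  have e : typePart ε (fderiv ℝ (expForm lam w k).1 x) =
      ((1 + ε) / 2 * Complex.exp (lam x.1)) • (baseForm lam).smulRight (w k) := by
    rw [h]
    refine ContinuousLinearMap.ext fun v => ContinuousAlternatingMap.ext fun u => ?_
    have hI : lam (mulI v).1 = Complex.I * lam v.1 := lam.map_smul Complex.I v.1
    simp [typePart, baseForm_apply, hI]
    linear_combination (-ε * Complex.exp (lam x.1) * lam v.1 * w k u / 2) * Complex.I_mul_I
  rw [partialDeriv, e, alternatize_smul, mul_smul]
  rfl

theorem partialDerivAll_zero_apply (ε : ℂ) (ω : AllForms n m) : partialDerivAll ε ω 0 = 0 := rfl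

theorem partialDerivAll_succ_apply (ε : ℂ) (ω : AllForms n m) (k : ℕ) (x : Coord n m) :
    (partialDerivAll ε ω (k + 1)).1 x = partialDeriv ε (ω k).1 x := rfl

theorem partialDerivAll_expForm (ε : ℂ) (lam : (Fin n → ℂ) →L[ℂ] ℂ) (w : Const n m) :
    partialDerivAll ε (expForm lam w) =
      ((1 + ε) / 2) • expForm lam (extAll (baseForm lam) w) := by
  funext k
  ext1
  funext x
  cases k with
  | zero =>
    rw [partialDerivAll_zero_apply]
    change 0 = ((1 + ε) / 2) • Complex.exp (lam x.1) • (0 : Coord n m [⋀^Fin 0]→L[ℝ] ℂ)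
    rw [smul_zero_alternating, smul_zero_alternating]
  | succ k => exact partialDeriv_expForm ε lam w k x

theorem del_expForm (lam : (Fin n → ℂ) →L[ℂ] ℂ) (w : Const n m) :
    del n m (expForm lam w) = expForm lam (extAll (baseForm lam) w) := by
  rw [del, partialDerivAll_expForm]
  norm_num

theorem delbar_expForm (lam : (Fin n → ℂ) →L[ℂ] ℂ) (w : Const n m) :
    delbar n m (expForm lam w) = 0 := by
  rw [delbar, partialDerivAll_expForm]
  norm_num

/-! ### Conjugation -/

theorem conj_apply (ω : AllForms n m) (k : ℕ) (x : Coord n m) (v : Fin k → Coord n m) :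
    (conj ω k).1 x v = starRingEnd ℂ ((ω k).1 x v) := rfl

/-- Conjugating the values exchanges the complex linear and antilinear parts of a derivative. The
scalar `ε` must be real because it is conjugated too. -/
theorem partialDerivAll_conj {ε : ℂ} (hε : starRingEnd ℂ ε = ε) (ω : AllForms n m) :
    partialDerivAll ε (conj ω) = conj (partialDerivAll (-ε) ω) := by
  funext k
  ext1
  funext x
  cases k with
  | zero =>
    ext v
    rw [conj_apply, partialDerivAll_zero_apply, partialDerivAll_zero_apply]
    exact (map_zero (starRingEnd ℂ)).symm
  | succ k =>
    let c := ContinuousLinearMap.compContinuousAlternatingMapCLM ℝ (Coord n m) ℂ ℂ (Fin k)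
      (Complex.conjCLE : ℂ →L[ℝ] ℂ)
    have hd : fderiv ℝ (conj ω k).1 x = c.comp (fderiv ℝ (ω k).1 x) :=
      (c.hasFDerivAt.comp x (FormDeg.differentiableAt (ω k) x).hasFDerivAt).fderiv
    ext v
    rw [conj_apply, partialDerivAll_succ_apply, partialDerivAll_succ_apply, partialDeriv,
      partialDeriv, hd, alternatizeUncurryFin_apply, alternatizeUncurryFin_apply, _root_.map_sum]
    refine Finset.sum_congr rfl fun i _ => ?_
    rw [map_zsmul]
    congr 1
    have h2 : starRingEnd ℂ 2 = 2 := Complex.conj_ofNat 2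
    simp [typePart, hε, c, h2]
    ring

theorem del_conj (ω : AllForms n m) : del n m (conj ω) = conj (delbar n m ω) :=
  partialDerivAll_conj (by simp) ω

theorem delbar_conj (ω : AllForms n m) : delbar n m (conj ω) = conj (del n m ω) := by
  simpa using! partialDerivAll_conj (ε := -1) (by simp) ω

/-! ### Translations and the characters of forms -/

/-- The pull-back of forms by the translation by `(a, 0)`. -/
def translate (a : Fin n → ℂ) : AllForms n m →ₗ[ℂ] AllForms n m where
  toFun ω k := ⟨fun x => (ω k).1 (x + (a, 0)),
    (FormDeg.contDiff (ω k)).comp (contDiff_id.add contDiff_const)⟩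
  map_add' _ _ := rfl
  map_smul' _ _ := rfl

/-- The forms on which the translations of `ℂⁿ` act by the function `χ`. -/
def characterSpace (χ : (Fin n → ℂ) → ℂ) : Submodule ℂ (AllForms n m) :=
  ⨅ a, Module.End.eigenspace (translate a) (χ a)

theorem mem_characterSpace {χ : (Fin n → ℂ) → ℂ} {ω : AllForms n m} :
    ω ∈ characterSpace χ ↔ ∀ a, translate a ω = χ a • ω := by
  simp [characterSpace, Submodule.mem_iInf]

theorem translate_comm (a b : Fin n → ℂ) :
    Commute (translate a : Module.End ℂ (AllForms n m)) (translate b) := by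
  refine LinearMap.ext fun ω => ?_
  funext k
  ext1
  funext x
  change (ω k).1 (x + (a, 0) + (b, 0)) = (ω k).1 (x + (b, 0) + (a, 0))
  rw [add_right_comm]

/-- Translations commute, so their simultaneous generalized eigenspaces are independent, and the
character spaces lie inside them. -/
theorem iSupIndep_characterSpace :
    iSupIndep fun χ : (Fin n → ℂ) → ℂ => (characterSpace χ : Submodule ℂ (AllForms n m)) := by
  have h := Module.End.independent_iInf_maxGenEigenspace_of_forall_mapsTo
    (fun a : Fin n → ℂ => (translate a : Module.End ℂ (AllForms n m))) fun a b φ =>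
      Module.End.mapsTo_maxGenEigenspace_of_comm (translate_comm b a) φ
  refine h.mono fun χ => ?_
  exact iInf_mono fun a => Module.End.eigenspace_le_maxGenEigenspace

theorem expForm_mem_characterSpace (lam : (Fin n → ℂ) →L[ℂ] ℂ) (w : Const n m) :
    expForm lam w ∈ characterSpace fun a => Complex.exp (lam a) := by
  refine mem_characterSpace.2 fun a => ?_
  funext k
  ext1
  funext x
  change Complex.exp (lam (x.1 + a)) • w k = Complex.exp (lam a) • Complex.exp (lam x.1) • w k
  rw [smul_smul, ← Complex.exp_add, map_add, add_comm]

theorem conj_mem_characterSpace {χ : (Fin n → ℂ) → ℂ} {ω : AllForms n m}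
    (h : ω ∈ characterSpace χ) : conj ω ∈ characterSpace fun a => starRingEnd ℂ (χ a) := by
  rw [mem_characterSpace] at h ⊢
  intro a
  rw [← map_smulₛₗ, ← h a]
  rfl

/-! ### The type of forms -/

/-- The pull-back of the values of forms by the multiplication by `s`. -/
def scale (s : ℂ) : AllForms n m →ₗ[ℂ] AllForms n m where
  toFun ω k := ⟨fun x => ((ω k).1 x).compContinuousLinearMap
      (s • ContinuousLinearMap.id ℝ (Coord n m)),
    (ContinuousAlternatingMap.compContinuousLinearMapCLM
      (s • ContinuousLinearMap.id ℝ (Coord n m)) :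
        (Coord n m [⋀^Fin k]→L[ℝ] ℂ) →L[ℝ] (Coord n m [⋀^Fin k]→L[ℝ] ℂ)).contDiff.comp
      (FormDeg.contDiff (ω k))⟩
  map_add' _ _ := rfl
  map_smul' _ _ := rfl

/-- The forms of type `(p,q)`, as far as the multiplication by `2 exp(i)` can tell. -/
def typeSpace (p q : ℤ) : Submodule ℂ (AllForms n m) :=
  Module.End.eigenspace (scale (2 * Complex.exp Complex.I))
    ((2 * Complex.exp Complex.I) ^ p * starRingEnd ℂ (2 * Complex.exp Complex.I) ^ q)

/-- The norm of the eigenvalue is 2^(p+q), which gives p + q. Its phase exp((p-q)i) gives p - q,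
because an integer multiple of 2π that is an integer is 0 by irrationality of π. -/
theorem two_mul_exp_I_injective : Function.Injective fun v : ℤ × ℤ =>
    (2 * Complex.exp Complex.I) ^ v.1 * starRingEnd ℂ (2 * Complex.exp Complex.I) ^ v.2 := by
  have key : ∀ v : ℤ × ℤ, (2 * Complex.exp Complex.I) ^ v.1 *
      starRingEnd ℂ (2 * Complex.exp Complex.I) ^ v.2 =
        2 ^ (v.1 + v.2) * Complex.exp ((v.1 - v.2 : ℤ) * Complex.I) := by
    intro v
    rw [map_mul, ← Complex.exp_conj, Complex.conj_I, map_ofNat, mul_zpow, mul_zpow,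
      zpow_add₀ two_ne_zero, ← Complex.exp_int_mul, ← Complex.exp_int_mul]
    have : ((v.1 - v.2 : ℤ) : ℂ) * Complex.I = v.1 * Complex.I + v.2 * -Complex.I := by
      push_cast; ring
    rw [this, Complex.exp_add]
    ring
  intro v v' h
  simp only [key] at h
  have hn := congrArg norm h
  have hnorm : ∀ j : ℤ, ‖Complex.exp (j * Complex.I)‖ = 1 := fun j => by
    exact_mod_cast Complex.norm_exp_ofReal_mul_I j
  rw [norm_mul, norm_mul, hnorm, hnorm, norm_zpow, norm_zpow, mul_one, mul_one] at hn
  have h1 : v.1 + v.2 = v'.1 + v'.2 :=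
    zpow_right_injective₀ (a := ‖(2 : ℂ)‖) (by norm_num) (by norm_num) hn
  rw [h1] at h
  have h2 := mul_left_cancel₀ (zpow_ne_zero _ two_ne_zero) h
  rw [Complex.exp_eq_exp_iff_exists_int] at h2
  obtain ⟨j, hj⟩ := h2
  have h3 : ((v.1 - v.2 : ℤ) : ℂ) = (v'.1 - v'.2 : ℤ) + j * (2 * Real.pi) := by
    apply mul_right_cancel₀ Complex.I_ne_zero
    rw [hj]; ring
  have h4 : ((v.1 - v.2 : ℤ) : ℝ) = (v'.1 - v'.2 : ℤ) + j * (2 * Real.pi) := by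
    exact_mod_cast h3
  have h5 : j = 0 := by
    by_contra hj0
    have : Irrational ((2 * j : ℤ) * Real.pi) :=
      irrational_pi.intCast_mul (mul_ne_zero two_ne_zero hj0)
    refine this.ne_int ((v.1 - v.2) - (v'.1 - v'.2)) ?_
    push_cast at h4 ⊢
    linarith
  have h6 : v.1 - v.2 = v'.1 - v'.2 := by
    rw [h5, Int.cast_zero, zero_mul, add_zero] at h4
    exact_mod_cast h4
  ext <;> omega

theorem iSupIndep_typeSpace :
    iSupIndep fun v : ℤ × ℤ => (typeSpace v.1 v.2 : Submodule ℂ (AllForms n m)) :=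
  (Module.End.eigenspaces_iSupIndep _).comp two_mul_exp_I_injective

theorem conj_mem_typeSpace {p q : ℤ} {ω : AllForms n m} (h : ω ∈ typeSpace p q) :
    conj ω ∈ typeSpace q p := by
  rw [typeSpace, Module.End.mem_eigenspace_iff] at h ⊢
  have e : scale (2 * Complex.exp Complex.I) (conj ω) =
    conj (scale (2 * Complex.exp Complex.I) ω) := rfl
  rw [e, h, map_smulₛₗ]
  congr 1
  rw [map_mul, map_zpow₀, map_zpow₀, Complex.conj_conj, mul_comm]

end Forms

end

/-! ### Characters of ℂⁿ and the double complex of the solvmanifold. -/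

noncomputable section

open Forms DoubleComplex

/-! ### Holomorphic characters -/

/-- A holomorphic character of `ℂⁿ` is the exponential of a linear function. -/
theorem exists_eq_exp_of_map_add {E : Type*} [NormedAddCommGroup E] [NormedSpace ℂ E] {ψ : E → ℂ}
    (h0 : ψ 0 = 1) (hadd : ∀ a b, ψ (a + b) = ψ a * ψ b) (hd : Differentiable ℂ ψ) :
    ∃ lam : E →L[ℂ] ℂ, ∀ z, ψ z = Complex.exp (lam z) := by
  set lam : E →L[ℂ] ℂ := fderiv ℂ ψ 0 with hlam
  -- Multiplicativity transports the derivative at 0 to every point, so `ψ` solves the differential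
  -- equation of exp λ and its quotient by exp λ is constant.
  have hψ : ∀ z, HasFDerivAt ψ (ψ z • lam) z := by
    intro z
    have h1 : HasFDerivAt ψ lam ((fun y => y - z) z) := by
      beta_reduce
      rw [sub_self]
      exact (hd 0).hasFDerivAt
    have h2 : HasFDerivAt (fun y => y - z) (ContinuousLinearMap.id ℂ E) z :=
      (hasFDerivAt_id z).sub_const z
    have h3 : HasFDerivAt (fun y => ψ z * ψ (y - z)) (ψ z • lam) z :=
      (HasFDerivAt.comp (g := ψ) (f := fun y => y - z) z h1 h2).const_mul (ψ z)
    simpa only [← hadd, add_sub_cancel] using h3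
  have hg : ∀ z, HasFDerivAt (fun z => ψ z * Complex.exp (-lam z)) (0 : E →L[ℂ] ℂ) z := by
    intro z
    have h2 : HasFDerivAt (fun z => Complex.exp (-lam z)) (Complex.exp (-lam z) • -lam) z :=
      lam.hasFDerivAt.neg.cexp
    have h3 : ψ z • Complex.exp (-lam z) • -lam + Complex.exp (-lam z) • ψ z • lam = 0 := by
      rw [smul_neg, smul_neg, smul_comm, neg_add_cancel]
    exact h3 ▸ (hψ z).mul h2
  refine ⟨lam, fun z => ?_⟩
  have hc := is_const_of_fderiv_eq_zero (𝕜 := ℂ) (fun z => (hg z).differentiableAt)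
    (fun z => (hg z).fderiv) z 0
  simp only [map_zero, neg_zero, Complex.exp_zero, mul_one, h0] at hc
  rw [Complex.exp_neg] at hc
  exact (mul_inv_eq_one₀ (Complex.exp_ne_zero _)).1 hc

/-- A holomorphic character that is also antiholomorphic is trivial. -/
theorem eq_zero_of_exp_eq_conj_exp {E : Type*} [NormedAddCommGroup E] [NormedSpace ℂ E]
    {lam lam' : E →L[ℂ] ℂ}
    (h : ∀ z, Complex.exp (lam z) = starRingEnd ℂ (Complex.exp (lam' z))) : lam = 0 := by
  let _ : NormedSpace ℝ E := NormedSpace.restrictScalars ℝ ℂ E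
  have h1 : HasFDerivAt (𝕜 := ℝ) (fun z => Complex.exp (lam z)) (lam.restrictScalars ℝ) 0 := by
    have := ((lam.restrictScalars ℝ).hasFDerivAt (x := 0)).cexp
    simpa using this
  have h2 : HasFDerivAt (𝕜 := ℝ) (fun z => starRingEnd ℂ (Complex.exp (lam' z)))
      ((Complex.conjCLE : ℂ →L[ℝ] ℂ).comp (lam'.restrictScalars ℝ)) 0 := by
    have := ((lam'.restrictScalars ℝ).hasFDerivAt (x := 0)).cexp
    have h3 := (Complex.conjCLE : ℂ →L[ℝ] ℂ).hasFDerivAt.comp (0 : E) this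
    simpa using! h3
  have e := h1.unique (by simpa only [h] using h2)
  have key : ∀ z, lam z = starRingEnd ℂ (lam' z) := fun z => by
    simpa using congrArg (fun f : E →L[ℝ] ℂ => f z) e
  ext z
  -- Derivatives at 0 show that `lam` is both complex linear and antilinear; evaluating at `I • z`
  -- forces it to vanish.
  have hz := key (Complex.I • z)
  rw [map_smul, map_smul, smul_eq_mul, smul_eq_mul, map_mul, ← key, Complex.conj_I] at hz
  have : (2 * Complex.I) * lam z = 0 := by linear_combination hz
  simpa using this

theorem AddChar.apply_ne_zero {E K : Type*} [AddGroup E] [Field K] (χ : AddChar E K) (z : E) :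
    χ z ≠ 0 := fun h => by
  have := χ.map_add_eq_mul z (-z)
  rw [add_neg_cancel, χ.map_zero_eq_one, h, zero_mul] at this
  exact one_ne_zero this

theorem Finset.prod_map_sort {α : Type*} [LinearOrder α] (s : Finset α) (f : α → ℂ) :
    (s.sort.map f).prod = ∏ i ∈ s, f i := by
  rw [((s.sort_perm_toList (· ≤ ·)).map f).prod_eq, Finset.prod_map_toList]

namespace SplittingSolvmanifold

variable {n m : ℕ} {X : SplittingSolvmanifold n m}

theorem leftTranslation_apply (g : X.G) (x : Coord n m) : X.leftTranslation g x =
    (g.right.toAdd + x.1, g.left.toAdd + X.φ g.right x.2) := rfl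

/-- The derivative of the left translation by `g`. -/
def translationDeriv (g : X.G) : Coord n m →L[ℝ] Coord n m :=
  (ContinuousLinearMap.id ℝ (Fin n → ℂ)).prodMap
    (LinearMap.toContinuousLinearMap ((X.φ g.right).toLinearMap.restrictScalars ℝ))

theorem translationDeriv_apply (g : X.G) (x : Coord n m) :
    translationDeriv g x = (x.1, X.φ g.right x.2) := rfl

theorem fderiv_leftTranslation (g : X.G) (x : Coord n m) :
    fderiv ℝ (X.leftTranslation g) x = translationDeriv g := by
  have e : X.leftTranslation g = fun x => (g.right.toAdd, g.left.toAdd) + translationDeriv g x :=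
    rfl
  rw [e]
  exact ((translationDeriv g).hasFDerivAt.const_add _).fderiv

theorem conj_mem_quotientForms {ω : AllForms n m} (h : ω ∈ X.quotientForms) :
    conj ω ∈ X.quotientForms := by
  intro g hg k x
  refine ContinuousAlternatingMap.ext fun v => ?_
  exact congrArg (starRingEnd ℂ)
    (congrArg (fun η : Coord n m [⋀^Fin k]→L[ℝ] ℂ => η v) (h g hg k x))

namespace Frame

variable (F : X.Frame)

/-! ### The coefficients -/

/-- Each factor is the inverse of a holomorphic character given by the frame, hence itself a
holomorphic character; the logarithms of the factors add. -/
theorem exists_coeff_eq_exp : ∃ lam : Finset (Fin m) → Finset (Fin m) → ((Fin n → ℂ) →L[ℂ] ℂ),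
    ∀ J L z, F.coeff J L z = Complex.exp (lam J L z) := by
  have hμ : ∀ j, ∃ lam : (Fin n → ℂ) →L[ℂ] ℂ,
      ∀ z, (F.α j z)⁻¹ * F.β j z = Complex.exp (lam z) := by
    intro j
    refine exists_eq_exp_of_map_add (by simp) (fun a b => ?_) ?_
    · simp only [AddChar.map_add_eq_mul, mul_inv]; ring
    · have h := (F.holomorphic_β j).inv fun z =>
        mul_ne_zero (AddChar.apply_ne_zero _ z) (inv_ne_zero (AddChar.apply_ne_zero _ z))
      refine (congrArg (Differentiable ℂ) (funext fun z => ?_)).mp h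
      simp [mul_comm]
  have hν : ∀ j, ∃ lam : (Fin n → ℂ) →L[ℂ] ℂ,
      ∀ z, (starRingEnd ℂ (F.α j z))⁻¹ * F.γ j z = Complex.exp (lam z) := by
    intro j
    refine exists_eq_exp_of_map_add (by simp) (fun a b => ?_) ?_
    · simp only [AddChar.map_add_eq_mul, mul_inv, map_mul]; ring
    · have h := (F.holomorphic_γ j).inv fun z =>
        mul_ne_zero ((map_ne_zero _).2 (AddChar.apply_ne_zero _ z))
          (inv_ne_zero (AddChar.apply_ne_zero _ z))
      refine (congrArg (Differentiable ℂ) (funext fun z => ?_)).mp h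
      simp [mul_comm]
  choose μ hμ using hμ
  choose ν hν using hν
  refine ⟨fun J L => ∑ j ∈ J, μ j + ∑ l ∈ L, ν l, fun J L z => ?_⟩
  simp only [coeff, hμ, hν, ← Complex.exp_sum, ← Complex.exp_add]
  congr 1
  simp

/-- The logarithm of the coefficient `(α_J⁻¹ β_J) (ᾱ_L⁻¹ γ_L)`. -/
def lam (J L : Finset (Fin m)) : (Fin n → ℂ) →L[ℂ] ℂ := F.exists_coeff_eq_exp.choose J L

theorem coeff_eq_exp (J L : Finset (Fin m)) (z : Fin n → ℂ) :
    F.coeff J L z = Complex.exp (F.lam J L z) := F.exists_coeff_eq_exp.choose_spec J L z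

/-- The generators `x_I ∧ (α_J⁻¹ β_J) y_J ∧ x̄_K ∧ (ᾱ_L⁻¹ γ_L) ȳ_L`. -/
def gen (I : Finset (Fin n)) (J : Finset (Fin m)) (K : Finset (Fin n)) (L : Finset (Fin m)) :
    AllForms n m := expForm (F.lam J L) (F.wedgeXY I J K L)

theorem B_eq_span (p q : ℤ) : F.B p q = Submodule.span ℂ {ω | ∃ (I : Finset (Fin n))
    (J : Finset (Fin m)) (K : Finset (Fin n)) (L : Finset (Fin m)),
    (I.card + J.card : ℤ) = p ∧ (K.card + L.card : ℤ) = q ∧ F.TrivialOnΓ J L ∧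
      F.gen I J K L = ω} := by
  rw [B]
  congr 1
  ext ω
  simp only [Set.mem_ofPred_eq]
  refine exists_congr fun I => exists_congr fun J => exists_congr fun K => exists_congr fun L =>
    and_congr_right fun _ => and_congr_right fun _ => and_congr_right fun _ => ?_
  simp only [coeff_eq_exp]
  refine ⟨fun h => ?_, fun h k x => ?_⟩
  · funext k
    ext1
    funext x
    exact (h k x).symm
  · rw [← h]; rfl

theorem gen_mem_B {I : Finset (Fin n)} {J : Finset (Fin m)} {K : Finset (Fin n)}
    {L : Finset (Fin m)} {p q : ℤ} (hp : (I.card + J.card : ℤ) = p) (hq : (K.card + L.card : ℤ) = q)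
    (h : F.TrivialOnΓ J L) : F.gen I J K L ∈ F.B p q := by
  rw [B_eq_span]
  exact Submodule.subset_span ⟨I, J, K, L, hp, hq, h, rfl⟩

theorem B_le {p q : ℤ} {M : Submodule ℂ (AllForms n m)}
    (h : ∀ (I : Finset (Fin n)) (J : Finset (Fin m)) (K : Finset (Fin n)) (L : Finset (Fin m)),
      (I.card + J.card : ℤ) = p → (K.card + L.card : ℤ) = q → F.TrivialOnΓ J L →
        F.gen I J K L ∈ M) : F.B p q ≤ M := by
  rw [B_eq_span]
  refine Submodule.span_le.2 ?_
  rintro _ ⟨I, J, K, L, hp, hq, hJL, rfl⟩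
  exact h I J K L hp hq hJL

theorem finite_B (p q : ℤ) : FiniteDimensional ℂ (F.B p q) := by
  rw [B_eq_span]
  refine FiniteDimensional.span_of_finite ℂ ((Set.finite_range
    fun v : Finset (Fin n) × Finset (Fin m) × Finset (Fin n) × Finset (Fin m) =>
      F.gen v.1 v.2.1 v.2.2.1 v.2.2.2).subset ?_)
  rintro _ ⟨I, J, K, L, -, -, -, rfl⟩
  exact ⟨(I, J, K, L), rfl⟩

theorem B_eq_bot {p q : ℤ} (h : ¬ ((0 ≤ p ∧ p ≤ n + m) ∧ (0 ≤ q ∧ q ≤ n + m))) :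
    F.B p q = ⊥ := by
  refine le_bot_iff.1 (F.B_le fun I J K L hp hq _ => (h ?_).elim)
  have hI := I.card_le_univ
  have hJ := J.card_le_univ
  have hK := K.card_le_univ
  have hL := L.card_le_univ
  rw [Fintype.card_fin] at hI hJ hK hL
  omega

/-! ### The generators as products of `1`-forms -/

/-- The indices of the forms `x_i`, `y_j`, `x̄_i`, `ȳ_j`. -/
abbrev Idx (n m : ℕ) : Type := (Fin n ⊕ Fin m) ⊕ (Fin n ⊕ Fin m)

/-- The forms `x_i`, `y_j`, `x̄_i`, `ȳ_j`. -/
def oneForm : Idx n m → Coord n m →L[ℝ] ℂ :=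
  Sum.elim (Sum.elim x F.y) (Sum.elim (fun i => bar (x i)) fun j => bar (F.y j))

/-- The list of the indices of the factors of `x_I ∧ y_J ∧ x̄_K ∧ ȳ_L`. -/
def idxList (I : Finset (Fin n)) (J : Finset (Fin m)) (K : Finset (Fin n)) (L : Finset (Fin m)) :
    List (Idx n m) :=
  I.sort.map (fun i => Sum.inl (Sum.inl i)) ++ J.sort.map (fun j => Sum.inl (Sum.inr j)) ++
    K.sort.map (fun i => Sum.inr (Sum.inl i)) ++ L.sort.map (fun j => Sum.inr (Sum.inr j))

theorem wedgeXY_eq (I : Finset (Fin n)) (J : Finset (Fin m)) (K : Finset (Fin n))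
    (L : Finset (Fin m)) :
    F.wedgeXY I J K L = wedgeAll ((idxList I J K L).map F.oneForm) := by
  simp only [wedgeXY, idxList, List.map_append, List.map_map]
  rfl

theorem prod_map_idxList (μ : Idx n m → ℂ) (I : Finset (Fin n)) (J : Finset (Fin m))
    (K : Finset (Fin n)) (L : Finset (Fin m)) : ((idxList I J K L).map μ).prod =
      (∏ i ∈ I, μ (.inl (.inl i))) * (∏ j ∈ J, μ (.inl (.inr j))) *
        (∏ i ∈ K, μ (.inr (.inl i))) * ∏ j ∈ L, μ (.inr (.inr j)) := by
  simp only [idxList, List.map_append, List.map_map, List.prod_append, Finset.prod_map_sort,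
    Function.comp_apply]

/-- A real linear map that multiplies the forms `x_i`, `y_j`, `x̄_i`, `ȳ_j` by scalars multiplies
their products by scalars. -/
theorem wedgeXY_compContinuousLinearMap {f : Coord n m →L[ℝ] Coord n m} {μ : Idx n m → ℂ}
    (h : ∀ i, (F.oneForm i).comp f = μ i • F.oneForm i)
    (I : Finset (Fin n)) (J : Finset (Fin m)) (K : Finset (Fin n)) (L : Finset (Fin m)) (k : ℕ) :
    (F.wedgeXY I J K L k).compContinuousLinearMap f =
      ((∏ i ∈ I, μ (.inl (.inl i))) * (∏ j ∈ J, μ (.inl (.inr j))) *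
        (∏ i ∈ K, μ (.inr (.inl i))) * ∏ j ∈ L, μ (.inr (.inr j))) • F.wedgeXY I J K L k := by
  rw [wedgeXY_eq, wedgeAll_map_compContinuousLinearMap F.oneForm μ f h, prod_map_idxList]

theorem exists_extAll_x_wedgeXY {i : Fin n} {I : Finset (Fin n)} (hi : i ∉ I) (J : Finset (Fin m))
    (K : Finset (Fin n)) (L : Finset (Fin m)) :
    ∃ c : ℂ, extAll (x i) (F.wedgeXY I J K L) = c • F.wedgeXY (insert i I) J K L := by
  have e : extAll (x i) (F.wedgeXY I J K L) =
      wedgeAll ((Sum.inl (Sum.inl i) :: idxList I J K L).map F.oneForm) := by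
    rw [List.map_cons, wedgeAll_cons, wedgeXY_eq]
    rfl
  rw [e, wedgeXY_eq]
  refine wedgeAll_perm (List.Perm.map _ ?_)
  have hp : ((insert i I).sort (· ≤ ·)).Perm (i :: I.sort (· ≤ ·)) :=
    ((insert i I).sort_perm_toList _).trans ((Finset.toList_insert hi).trans
      ((I.sort_perm_toList _).symm.cons i))
  exact ((((hp.map fun i => (Sum.inl (Sum.inl i) : Idx n m)).append_right _).append_right
    _).append_right _).symm

theorem extAll_x_wedgeXY_of_mem {i : Fin n} {I : Finset (Fin n)} (hi : i ∈ I) (J : Finset (Fin m))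
    (K : Finset (Fin n)) (L : Finset (Fin m)) : extAll (x i) (F.wedgeXY I J K L) = 0 := by
  rw [wedgeXY_eq]
  refine extAll_wedgeAll_of_mem (List.mem_map.2 ⟨Sum.inl (Sum.inl i), ?_, rfl⟩)
  simp [idxList, hi]

theorem baseForm_eq_sum (lam : (Fin n → ℂ) →L[ℂ] ℂ) :
    (baseForm lam : Coord n m →L[ℝ] ℂ) = ∑ i, lam (Pi.single i 1) • x i := by
  refine ContinuousLinearMap.ext fun v => ?_
  have : v.1 = ∑ i, v.1 i • Pi.single (M := fun _ => ℂ) i 1 := by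
    funext j
    simp [Finset.sum_apply, Pi.single_apply]
  rw [baseForm_apply, this, map_sum]
  simp [x, mul_comm]

/-! ### Differentials of the generators -/

theorem del_gen (I : Finset (Fin n)) (J : Finset (Fin m)) (K : Finset (Fin n))
    (L : Finset (Fin m)) : del n m (F.gen I J K L) =
      expForm (F.lam J L) (extAll (baseForm (F.lam J L)) (F.wedgeXY I J K L)) :=
  del_expForm _ _

/-- The differential of λ involves only the forms `x i`, so ∂ enlarges `I` and leaves `J`, `L`, the
coefficient and the condition on Γ unchanged. -/
theorem del_mem_B {p q : ℤ} {ω : AllForms n m} (h : ω ∈ F.B p q) :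
    del n m ω ∈ F.B (p + 1) q := by
  have : F.B p q ≤ (F.B (p + 1) q).comap (del n m) := by
    refine F.B_le fun I J K L hp hq hJL => ?_
    rw [Submodule.mem_comap, del_gen, baseForm_eq_sum, extAll_sum_left, map_sum]
    refine Submodule.sum_mem _ fun i _ => ?_
    rw [extAll_smul_left, map_smul]
    refine Submodule.smul_mem _ _ ?_
    by_cases hi : i ∈ I
    · rw [extAll_x_wedgeXY_of_mem F hi, map_zero]
      exact zero_mem _
    · obtain ⟨c, hc⟩ := F.exists_extAll_x_wedgeXY hi J K L
      rw [hc, map_smul]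
      refine Submodule.smul_mem _ _ (F.gen_mem_B ?_ hq hJL)
      rw [Finset.card_insert_of_notMem hi]
      push_cast
      linarith
  exact this h

theorem delbar_eq_zero_of_mem_B {p q : ℤ} {ω : AllForms n m} (h : ω ∈ F.B p q) :
    delbar n m ω = 0 := by
  have : F.B p q ≤ LinearMap.ker (delbar n m) :=
    F.B_le fun I J K L _ _ _ => delbar_expForm _ _
  exact this h

theorem del_del_eq_zero_of_mem_B {p q : ℤ} {ω : AllForms n m} (h : ω ∈ F.B p q) :
    del n m (del n m ω) = 0 := by
  have : F.B p q ≤ LinearMap.ker (del n m ∘ₗ del n m) := by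
    refine F.B_le fun I J K L _ _ _ => ?_
    rw [LinearMap.mem_ker, LinearMap.comp_apply, del_gen, del_expForm, extAll_self, map_zero]
  exact this h

theorem del_eq_zero_of_mem_Bbar {p q : ℤ} {ω : AllForms n m} (h : ω ∈ F.Bbar p q) :
    del n m ω = 0 := by
  obtain ⟨b, hb, rfl⟩ := h
  rw [del_conj, F.delbar_eq_zero_of_mem_B hb, map_zero]

theorem delbar_mem_Bbar {p q : ℤ} {ω : AllForms n m} (h : ω ∈ F.Bbar p q) :
    delbar n m ω ∈ F.Bbar p (q + 1) := by
  obtain ⟨b, hb, rfl⟩ := h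
  rw [delbar_conj]
  exact ⟨_, F.del_mem_B hb, rfl⟩

theorem delbar_delbar_eq_zero_of_mem_Bbar {p q : ℤ} {ω : AllForms n m} (h : ω ∈ F.Bbar p q) :
    delbar n m (delbar n m ω) = 0 := by
  obtain ⟨b, hb, rfl⟩ := h
  rw [delbar_conj, delbar_conj, F.del_del_eq_zero_of_mem_B hb, map_zero]

/-! ### Invariance and type -/

theorem oneForm_comp_translationDeriv (g : X.G) (i : Idx n m) :
    (F.oneForm i).comp (translationDeriv g) =
      (Sum.elim (Sum.elim (fun _ => 1) fun j => F.α j g.right.toAdd)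
        (Sum.elim (fun _ => 1) fun j => starRingEnd ℂ (F.α j g.right.toAdd)) i : ℂ) •
          F.oneForm i := by
  have hy : ∀ (j : Fin m) (w : Fin m → ℂ),
      F.Y.coord j (X.φ g.right w) = F.α j g.right.toAdd * F.Y.coord j w := by
    intro j w
    have : F.Y.coord j ∘ₗ (X.φ g.right).toLinearMap = F.α j g.right.toAdd • F.Y.coord j := by
      refine F.Y.ext fun i => ?_
      have := F.action g.right.toAdd i
      rw [ofAdd_toAdd] at this
      rw [LinearMap.comp_apply, LinearEquiv.coe_coe, this, map_smul, LinearMap.smul_apply,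
        Module.Basis.coord_apply, Module.Basis.repr_self, smul_eq_mul, smul_eq_mul]
      by_cases hij : i = j
      · rw [hij]
      · rw [Finsupp.single_eq_of_ne (Ne.symm hij), mul_zero, mul_zero]
    exact congrArg (fun f : (Fin m → ℂ) →ₗ[ℂ] ℂ => f w) this
  refine ContinuousLinearMap.ext fun v => ?_
  rcases i with (i | j) | (i | j)
  · simp [oneForm, x, translationDeriv_apply]
  · exact hy j v.2
  · simp [oneForm, x, bar, translationDeriv_apply]
  · exact (congrArg (starRingEnd ℂ) (hy j v.2)).trans (map_mul _ _ _)

/-- Pull-back by g multiplies y_J ∧ ȳ_L by α_J ᾱ_L at g and the coefficient by its own value at g.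
The product is β_J γ_L at g, which is 1 on Γ. -/
theorem gen_mem_quotientForms (I : Finset (Fin n)) {J : Finset (Fin m)} (K : Finset (Fin n))
    {L : Finset (Fin m)} (h : F.TrivialOnΓ J L) : F.gen I J K L ∈ X.quotientForms := by
  intro g hg k x
  rw [fderiv_leftTranslation, leftTranslation_apply]
  change (Complex.exp (F.lam J L (g.right.toAdd + x.1)) •
    F.wedgeXY I J K L k).compContinuousLinearMap (translationDeriv g) =
      Complex.exp (F.lam J L x.1) • F.wedgeXY I J K L k
  have hs : ∀ (c : ℂ) (η : Coord n m [⋀^Fin k]→L[ℝ] ℂ) (f : Coord n m →L[ℝ] Coord n m),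
      (c • η).compContinuousLinearMap f = c • η.compContinuousLinearMap f := fun _ _ _ => rfl
  rw [hs, F.wedgeXY_compContinuousLinearMap (F.oneForm_comp_translationDeriv g), smul_smul,
    map_add, Complex.exp_add, ← coeff_eq_exp]
  congr 1
  have h1 := h g hg
  simp only [Sum.elim_inl, Sum.elim_inr, Finset.prod_const_one, one_mul, mul_one, coeff,
    Finset.prod_mul_distrib, Finset.prod_inv_distrib]
  have e1 : ∏ j ∈ J, F.α j g.right.toAdd ≠ 0 :=
    Finset.prod_ne_zero_iff.2 fun j _ => AddChar.apply_ne_zero _ _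
  have e2 : ∏ j ∈ L, starRingEnd ℂ (F.α j g.right.toAdd) ≠ 0 :=
    Finset.prod_ne_zero_iff.2 fun j _ => (map_ne_zero _).2 (AddChar.apply_ne_zero _ _)
  field_simp
  linear_combination h1

theorem B_le_quotientForms (p q : ℤ) : F.B p q ≤ X.quotientForms :=
  F.B_le fun I _ K _ _ _ h => F.gen_mem_quotientForms I K h

theorem C_le_quotientForms (p q : ℤ) : F.C p q ≤ X.quotientForms := by
  refine sup_le (F.B_le_quotientForms p q) ?_
  rintro _ ⟨b, hb, rfl⟩
  exact conj_mem_quotientForms (F.B_le_quotientForms q p hb)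

/-- Each unbarred 1-form is scaled by `s` and each barred one by its conjugate; there are `p` of the
first and `q` of the second. -/
theorem B_le_typeSpace (p q : ℤ) : F.B p q ≤ typeSpace p q := by
  refine F.B_le fun I J K L hp hq _ => ?_
  rw [typeSpace, Module.End.mem_eigenspace_iff]
  set s := 2 * Complex.exp Complex.I
  have hf : ∀ i : Idx n m, (F.oneForm i).comp (s • ContinuousLinearMap.id ℝ (Coord n m)) =
      (Sum.elim (fun _ => s) (fun _ => starRingEnd ℂ s) i : ℂ) • F.oneForm i := by
    intro i
    refine ContinuousLinearMap.ext fun v => ?_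
    rcases i with (i | j) | (i | j) <;> simp [oneForm, x, y, bar]
  funext k
  ext1
  funext x
  have h := F.wedgeXY_compContinuousLinearMap hf I J K L k
  change Complex.exp (F.lam J L x.1) • (F.wedgeXY I J K L k).compContinuousLinearMap
    (s • ContinuousLinearMap.id ℝ (Coord n m)) =
      (s ^ p * starRingEnd ℂ s ^ q) • Complex.exp (F.lam J L x.1) • F.wedgeXY I J K L k
  rw [h, smul_comm]
  congr 1
  simp only [Sum.elim_inl, Sum.elim_inr, Finset.prod_const, ← hp, ← hq, mul_assoc]
  rw [← mul_assoc, ← pow_add, ← pow_add, ← Nat.cast_add, ← Nat.cast_add, zpow_natCast,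
    zpow_natCast]

theorem C_le_typeSpace (p q : ℤ) : F.C p q ≤ typeSpace p q := by
  refine sup_le (F.B_le_typeSpace p q) ?_
  rintro _ ⟨b, hb, rfl⟩
  exact conj_mem_typeSpace (F.B_le_typeSpace q p hb)

/-! ### The double complex -/

theorem finite_C (p q : ℤ) : FiniteDimensional ℂ (F.C p q) := by
  have := F.finite_B p q
  have : FiniteDimensional ℂ (F.Bbar p q) := by
    have := F.finite_B q p
    exact Module.Finite.iff_fg.2 ((Module.Finite.iff_fg.1 this).map conj)
  exact Submodule.finiteDimensional_sup _ _

theorem C_eq_bot {p q : ℤ} (h : ¬ ((0 ≤ p ∧ p ≤ n + m) ∧ (0 ≤ q ∧ q ≤ n + m))) :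
    F.C p q = ⊥ := by
  rw [C, Bbar, F.B_eq_bot h, F.B_eq_bot (by tauto), Submodule.map_bot, sup_bot_eq]

/-- On B + B̄, ∂ sees only the B-component and ∂̄ only the other one. Both mixed second derivatives
therefore vanish, not merely their sum. -/
theorem isDoubleComplex_C : IsDoubleComplex (del n m) (delbar n m) F.C where
  independent := iSupIndep_typeSpace.mono fun v => F.C_le_typeSpace v.1 v.2
  stable := by
    constructor
    · intro p q a ha
      obtain ⟨b, hb, c, hc, rfl⟩ := Submodule.mem_sup.1 ha
      rw [map_add, F.del_eq_zero_of_mem_Bbar hc, add_zero]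
      exact Submodule.mem_sup_left (F.del_mem_B hb)
    · intro p q a ha
      obtain ⟨b, hb, c, hc, rfl⟩ := Submodule.mem_sup.1 ha
      rw [map_add, F.delbar_eq_zero_of_mem_B hb, zero_add]
      exact Submodule.mem_sup_right (F.delbar_mem_Bbar hc)
  d1_d1 p q a ha := by
    obtain ⟨b, hb, c, hc, rfl⟩ := Submodule.mem_sup.1 ha
    rw [map_add, F.del_eq_zero_of_mem_Bbar hc, add_zero, F.del_del_eq_zero_of_mem_B hb]
  d2_d2 p q a ha := by
    obtain ⟨b, hb, c, hc, rfl⟩ := Submodule.mem_sup.1 ha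
    rw [map_add, F.delbar_eq_zero_of_mem_B hb, zero_add, F.delbar_delbar_eq_zero_of_mem_Bbar hc]
  anticomm p q a ha := by
    obtain ⟨b, hb, c, hc, rfl⟩ := Submodule.mem_sup.1 ha
    rw [map_add (delbar n m), map_add (del n m) b, F.delbar_eq_zero_of_mem_B hb,
      F.del_eq_zero_of_mem_Bbar hc, zero_add, add_zero,
      F.del_eq_zero_of_mem_Bbar (F.delbar_mem_Bbar hc),
      F.delbar_eq_zero_of_mem_B (F.del_mem_B hb), add_zero]

/-- The nontrivial holomorphic characters. -/
def holomorphicChars (n : ℕ) : Set ((Fin n → ℂ) → ℂ) :=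
  {χ | ∃ lam : (Fin n → ℂ) →L[ℂ] ℂ, lam ≠ 0 ∧ (fun a => Complex.exp (lam a)) = χ}

/-- The antiholomorphic characters. -/
def antiholomorphicChars (n : ℕ) : Set ((Fin n → ℂ) → ℂ) :=
  {χ | ∃ lam : (Fin n → ℂ) →L[ℂ] ℂ, (fun a => starRingEnd ℂ (Complex.exp (lam a))) = χ}

/-- The trivial character is both holomorphic and antiholomorphic; it suffices to exclude it on the
holomorphic side. -/
theorem disjoint_chars : Disjoint (holomorphicChars n) (antiholomorphicChars n) := by
  rw [Set.disjoint_left]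
  rintro _ ⟨l, hl, rfl⟩ ⟨l', h⟩
  exact hl (eq_zero_of_exp_eq_conj_exp fun z => (congrFun h z).symm)

/-- A generator with λ = 0 has constant coefficients and is ∂-closed, so only nontrivial characters
occur in the image. -/
theorem del_mem_of_mem_B {p q : ℤ} {ω : AllForms n m} (h : ω ∈ F.B p q) :
    del n m ω ∈ ⨆ χ ∈ holomorphicChars n, (characterSpace χ : Submodule ℂ (AllForms n m)) := by
  have : F.B p q ≤ (⨆ χ ∈ holomorphicChars n,
      (characterSpace χ : Submodule ℂ (AllForms n m))).comap (del n m) := by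
    refine F.B_le fun I J K L _ _ _ => ?_
    rw [Submodule.mem_comap, del_gen]
    by_cases h0 : F.lam J L = 0
    · have hb : (baseForm (0 : (Fin n → ℂ) →L[ℂ] ℂ) : Coord n m →L[ℝ] ℂ) = 0 := rfl
      rw [h0, hb, extAll_zero_left, map_zero]
      exact zero_mem _
    · exact Submodule.mem_iSup_of_mem _ (Submodule.mem_iSup_of_mem ⟨_, h0, rfl⟩
        (expForm_mem_characterSpace _ _))
  exact this h

theorem delbar_mem_of_mem_Bbar {p q : ℤ} {ω : AllForms n m} (h : ω ∈ F.Bbar p q) :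
    delbar n m ω ∈
      ⨆ χ ∈ antiholomorphicChars n, (characterSpace χ : Submodule ℂ (AllForms n m)) := by
  obtain ⟨b, hb, rfl⟩ := h
  rw [delbar_conj]
  have : F.B q p ≤ (⨆ χ ∈ antiholomorphicChars n,
      (characterSpace χ : Submodule ℂ (AllForms n m))).comap (conj.comp (del n m)) := by
    refine F.B_le fun I J K L _ _ _ => ?_
    rw [Submodule.mem_comap, LinearMap.comp_apply, del_gen]
    exact Submodule.mem_iSup_of_mem _ (Submodule.mem_iSup_of_mem ⟨_, rfl⟩
      (conj_mem_characterSpace (expForm_mem_characterSpace _ _)))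
  exact this hb

/-- B and B̄ supply the ∂̄-closed and ∂-closed components. A common value of ∂ and ∂̄ would lie in
two independent sums of character spaces, so it is zero. -/
theorem isShort_C : IsShort (del n m) (delbar n m) F.C where
  exists_add p q a ha := by
    obtain ⟨b, hb, c, hc, rfl⟩ := Submodule.mem_sup.1 ha
    exact ⟨c, Submodule.mem_sup_right hc, b, Submodule.mem_sup_left hb,
      F.del_eq_zero_of_mem_Bbar hc, F.delbar_eq_zero_of_mem_B hb, add_comm _ _⟩
  eq_zero p q p' q' _ _ a ha b hb hab := by
    obtain ⟨a1, ha1, a2, ha2, rfl⟩ := Submodule.mem_sup.1 ha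
    obtain ⟨b1, hb1, b2, hb2, rfl⟩ := Submodule.mem_sup.1 hb
    rw [map_add, map_add, F.del_eq_zero_of_mem_Bbar ha2, F.delbar_eq_zero_of_mem_B hb1, add_zero,
      zero_add] at hab
    rw [map_add, F.del_eq_zero_of_mem_Bbar ha2, add_zero]
    refine Submodule.disjoint_def.1 (iSupIndep_characterSpace.disjoint_biSup_biSup disjoint_chars) _
      (F.del_mem_of_mem_B ha1) ?_
    rw [hab]
    exact F.delbar_mem_of_mem_Bbar hb2

end Frame

end SplittingSolvmanifold

end

theorem mainTheorem5 {n m : ℕ} (X : SplittingSolvmanifold n m) (F : X.Frame) :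
    -- `∂̄ = 0` on `B_Γ` and `∂ = 0` on `B̄_Γ`
    (∀ p q : ℤ, ∀ ω ∈ F.B p q, Forms.delbar n m ω = 0) ∧
    (∀ p q : ℤ, ∀ ω ∈ F.Bbar p q, Forms.del n m ω = 0) ∧
    -- `C_Γ` is a double complex of forms on the solvmanifold
    (∀ p q : ℤ, F.C p q ≤ X.quotientForms) ∧
    DoubleComplex.IsDoubleComplex (Forms.del n m) (Forms.delbar n m) F.C ∧
    -- `C_Γ` is a direct sum of dots and zigzags of length two
    (∃ (r : ℕ) (D : Fin r → ℤ → ℤ → Submodule ℂ (Forms.AllForms n m)) (S : Fin r → Set (ℤ × ℤ)),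
      DoubleComplex.IsDecomposition (Forms.del n m) (Forms.delbar n m) F.C D S ∧
      ∀ i, DoubleComplex.IsDotShape (S i) ∨ DoubleComplex.IsLineShape (S i)) ∧
    -- and only those occur in any decomposition of `C_Γ` into squares and zigzags
    (∀ (ι : Type) (D : ι → ℤ → ℤ → Submodule ℂ (Forms.AllForms n m)) (S : ι → Set (ℤ × ℤ)),
      DoubleComplex.IsDecomposition (Forms.del n m) (Forms.delbar n m) F.C D S →
      ∀ i, DoubleComplex.IsDotShape (S i) ∨ DoubleComplex.IsLineShape (S i)) ∧
    -- `C_Γ` has the page-`1`-`∂∂̄`-property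
    DoubleComplex.HasPageOneDdbarProperty (Forms.del n m) (Forms.delbar n m) F.C ∧
    -- if a decomposition of `C_Γ` has no lines, then `C_Γ` satisfies the `∂∂̄`-Lemma
    (∀ (ι : Type) (D : ι → ℤ → ℤ → Submodule ℂ (Forms.AllForms n m)) (S : ι → Set (ℤ × ℤ)),
      DoubleComplex.IsDecomposition (Forms.del n m) (Forms.delbar n m) F.C D S →
      (∀ i, ¬ DoubleComplex.IsLineShape (S i)) →
      DoubleComplex.SatisfiesDdbarLemma (Forms.del n m) (Forms.delbar n m) F.C) := by
  exact ⟨fun _ _ _ => F.delbar_eq_zero_of_mem_B, fun _ _ _ => F.del_eq_zero_of_mem_Bbar,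
    F.C_le_quotientForms, F.isDoubleComplex_C,
    F.isDoubleComplex_C.exists_isDecomposition F.isShort_C F.finite_C
      -- There are `n + m` unbarred and `n + m` barred 1-forms, so all nonzero bidegrees lie in this
      -- box.
      (Finset.Icc 0 (n + m : ℤ) ×ˢ Finset.Icc 0 (n + m : ℤ))
      fun p q h => F.C_eq_bot fun h' => h (by simpa using h'),
    fun _ _ _ h => h.isDotShape_or_isLineShape F.isShort_C,
    F.isDoubleComplex_C.hasPageOneDdbarProperty F.isShort_C,
    fun _ _ _ h hS => h.satisfiesDdbarLemma fun i =>
      (h.isDotShape_or_isLineShape F.isShort_C i).resolve_right (hS i)⟩
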